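/- Let $X$ be a CAT(0) space: a metric space in which any two points are joined by a geodesic (a curve $\alpha$ with $d(\alpha(s),\alpha(s'))=|s-s'|$), and in which the distance between two points of a geodesic triangle is at most the distance between the corresponding points of the triangle with the same side lengths in the Euclidean plane. For $x,z\neq y$ in $X$, the angle at $y$ between the geodesics $[y,x]$ and $[y,z]$ is the greatest lower bound, over $u\in[y,x]\setminus\{y\}$ and $v\in[y,z]\setminus\{y\}$, of the angle at the vertex corresponding to $y$ in the Euclidean triangle with side lengths $d(y,u),d(y,v),d(u,v)$. The total rotation of a polygonal curve with successive vertices $v_0,\dots,v_n$ ($v_i\ne v_{i+1}$) is $\sum_{i=1}^{n-1}(\pi-\beta_i)$, where $\beta_i$ is the angle at $v_i$ between $[v_i,v_{i-1}]$ and $[v_i,v_{i+1}]$. The total curvature of a curve $\gamma:[a,b]\to X$ is the $\limsup$, as the maximum segment length tends to $0$, of the total rotations of the polygonal curves inscribed in $\gamma$, that is, with vertices $\gamma(u_0),\dots,\gamma(u_n)$ where $a=u_0<\dots<u_n=b$. Let $\gamma:[0,\infty)\to X$ be a curve parametrized by arclength, let $\tau(t)$ be the total curvature of $\gamma|_{[0,t]}$,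 and let $c(t)$ be the smallest $r$ such that $\gamma([0,t])$ lies in the closed ball of radius $r$ about $\gamma(0)$. Suppose that $\gamma$ has finite total curvature $\tau_\gamma=\lim_{t\to\infty}\tau(t)<\infty$. A geodesic ray is a map $\sigma:[0,\infty)\to X$ with $d(\sigma(s),\sigma(s'))=|s-s'|$ for all $s,s'\ge 0$, and $d(\gamma(t),\sigma)$ denotes the distance from $\gamma(t)$ to its image. Then: (a) If $X$ is complete, then for every point $p\in X$ there is a geodesic ray $\sigma$ starting at $p$ such that $d(\gamma(t),\sigma)=o(t)$ as $t\to\infty$. (b) $c\in\Omega(t)$, that is, there are $A>0$ and $t_0$ with $c(t)\ge At$ for all $t\ge t_0$. (c) If $\int_0^\infty(\tau_\gamma-\tau(t))\,dt<\infty$, then $\gamma$ is asymptotic to every geodesic ray $\sigma$ with $d(\gamma(t),\sigma)=o(t)$, in particular to those in (a); that is, $d(\gamma(t),\sigma)$ is bounded on $[0,\infty)$. -/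

import Mathlib

open scoped ENNReal NNReal Topology Asymptotics

namespace CatZero

/-- `σ`, restricted to `[0, dist x y]`, is a (unit-speed, minimizing) geodesic from `x` to `y`. -/
def IsGeodesicFromTo {X : Type*} [MetricSpace X] (σ : ℝ → X) (x y : X) : Prop :=
  σ 0 = x ∧ σ (dist x y) = y ∧
    ∀ s ∈ Set.Icc 0 (dist x y), ∀ t ∈ Set.Icc 0 (dist x y), dist (σ s) (σ t) = |s - t|

/-- The points lying on a geodesic from `x` to `y` (in a CAT(0) space this geodesic is unique). -/
def geodesicSegment {X : Type*} [MetricSpace X] (x y : X) : Set X :=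
  {z | ∃ σ : ℝ → X, IsGeodesicFromTo σ x y ∧ z ∈ σ '' Set.Icc 0 (dist x y)}

/-- A geodesic metric space is CAT(0) if the distance between two points `u`, `v` of a geodesic
triangle `p q r` is at most the distance between the corresponding points `u'`, `v'` of a model
triangle `p' q' r'` in the Euclidean plane. Up to relabelling the vertices, points on two
different sides are `u ∈ [p, q]` and `v ∈ [p, r]`; for two points on one side there is nothing
to require. -/
structure IsCAT0 (X : Type*) [MetricSpace X] : Prop where
  exists_geodesic : ∀ x y : X, ∃ σ : ℝ → X, IsGeodesicFromTo σ x y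
  dist_le_model : ∀ p q r u v : X, u ∈ geodesicSegment p q → v ∈ geodesicSegment p r →
    ∀ p' q' r' u' v' : EuclideanSpace ℝ (Fin 2),
      dist p' q' = dist p q → dist p' r' = dist p r → dist q' r' = dist q r →
      dist p' u' = dist p u → dist u' q' = dist u q →
      dist p' v' = dist p v → dist v' r' = dist v r →
      dist u v ≤ dist u' v'

/-- The angle at the vertex corresponding to `y` in a Euclidean model triangle of `u y v`,
for `u ≠ y` and `v ≠ y`. -/
noncomputable def modelAngle {X : Type*} [MetricSpace X] (u y v : X) : ℝ :=
  Real.arccos ((dist y u ^ 2 + dist y v ^ 2 - dist u v ^ 2) / (2 * dist y u * dist y v))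

/-- The angle at `y` between the geodesics from `y` to `x` and from `y` to `z`, for `x ≠ y` and
`z ≠ y`: the greatest lower bound of the model angles of the triangles cut off by
initial subsegments of the two geodesics. -/
noncomputable def angle {X : Type*} [MetricSpace X] (x y z : X) : ℝ :=
  sInf {θ | ∃ u ∈ geodesicSegment y x, ∃ v ∈ geodesicSegment y z,
    u ≠ y ∧ v ≠ y ∧ θ = modelAngle u y v}

/-- The total rotation of the polygonal curve with successive vertices `v 0, …, v n`: the sum of
`π - βᵢ` over the angles `βᵢ` at the interior vertices `v 1, …, v (n - 1)`. -/
noncomputable def totalRotation {X : Type*} [MetricSpace X] (n : ℕ) (v : ℕ → X) : ℝ :=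
  ∑ i ∈ Finset.range (n - 1), (Real.pi - angle (v i) (v (i + 1)) (v (i + 2)))

/-- The parameters `a = u 0 < u 1 < ⋯ < u n = b` define a polygonal curve inscribed in
`γ` restricted to `[a, b]`, none of whose segments degenerates to a point. -/
structure IsInscribed {X : Type*} [MetricSpace X] (γ : ℝ → X) (a b : ℝ) (n : ℕ) (u : ℕ → ℝ) :
    Prop where
  first : u 0 = a
  last : u n = b
  lt_succ : ∀ i < n, u i < u (i + 1)
  ne_succ : ∀ i < n, γ (u i) ≠ γ (u (i + 1))

/-- The total curvature of `γ` restricted to `[a, b]`: the limsup of the total rotations of the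
inscribed polygonal curves as the maximum segment length tends to `0`. -/
noncomputable def totalCurvature {X : Type*} [MetricSpace X] (γ : ℝ → X) (a b : ℝ) : ℝ≥0∞ :=
  ⨅ (δ : ℝ) (_ : 0 < δ), ⨆ (n : ℕ) (u : ℕ → ℝ) (_ : IsInscribed γ a b n u)
    (_ : ∀ i < n, dist (γ (u i)) (γ (u (i + 1))) < δ),
    ENNReal.ofReal (totalRotation n fun i => γ (u i))

/-- The circumradius function: the smallest `r` such that `γ` restricted to `[0, t]` lies in the
ball of radius `r` about `γ 0`. -/
noncomputable def circumradius {X : Type*} [MetricSpace X] (γ : ℝ → X) (t : ℝ) : ℝ :=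
  sInf {r | γ '' Set.Icc 0 t ⊆ Metric.closedBall (γ 0) r}

/-- `σ`, restricted to `[0, ∞)`, is a geodesic ray. -/
def IsGeodesicRay {X : Type*} [MetricSpace X] (σ : ℝ → X) : Prop :=
  ∀ s, 0 ≤ s → ∀ t, 0 ≤ t → dist (σ s) (σ t) = |s - t|

/-- The distance from a point to (the image of) a ray defined on `[0, ∞)`. -/
noncomputable def distToRay {X : Type*} [MetricSpace X] (x : X) (σ : ℝ → X) : ℝ :=
  Metric.infDist x (σ '' Set.Ici 0)

/-- The curve `γ` on `[0, ∞)` is asymptotic to the ray `σ`. -/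
def IsAsymptotic {X : Type*} [MetricSpace X] (γ σ : ℝ → X) : Prop :=
  ∃ C : ℝ, ∀ t, 0 ≤ t → distToRay (γ t) σ ≤ C

end CatZero

/-! Everything rests on one estimate for polygons of total rotation at most `K < π / 2`
(`polygon_fan`). Cut the polygon into triangles from its first vertex. Euclidean model angles add up
to `π` and dominate the angles of the space, so by induction the angle between the last edge and the
chord, plus all apex angles of the fan, is at most the total rotation. Hence each new edge leaves
the chord at an exterior angle at most `K`, and the chord grows at least at rate `cos K`; and since
the apex angles add up to at most `K`, a vertex at distance `d` from the start lies within `K * d`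
of the whole chord. Fine inscribed polygons carry both facts to curves (`curve_chord`,
`curve_dist_chord`).

Total curvature is superadditive, so far tails of `γ` have arbitrarily small curvature. The chord
estimate for a tail gives linear growth, which is (b). For (a), `γ t` is within `o(t)` of every
segment from `p` to a later point `γ t'`, uniformly in `t'`; shrinking towards `p` makes these
segments Cauchy at each fixed radius, and their limit is the ray. For (c), the distance to a ray is
convex along a long chord from `γ s`, and sublinearity at the far end makes its slope there
negligible. So this distance grows from `s` at a rate at most the curvature remaining after `s`,
which is integrable. -/

namespace CatZero

/-! ### Euclidean model triangles -/

theorem inner_vsub_vsub_eq (p q r : EuclideanSpace ℝ (Fin 2)) :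
    inner ℝ (q - p) (r - p) = (dist p q ^ 2 + dist p r ^ 2 - dist q r ^ 2) / 2 := by
  have h := norm_sub_sq_real (q - p) (r - p)
  rw [sub_sub_sub_cancel_right] at h
  rw [dist_comm p q, dist_comm p r, dist_eq_norm, dist_eq_norm, dist_eq_norm]
  linarith

section Metric

variable {X : Type*} [MetricSpace X]

theorem exists_model_triangle (p q r : X) : ∃ p' q' r' : EuclideanSpace ℝ (Fin 2),
    dist p' q' = dist p q ∧ dist p' r' = dist p r ∧ dist q' r' = dist q r := by
  rcases eq_or_ne p q with rfl | hpq
  · refine ⟨0, 0, !₂[dist p r, 0], by simp, ?_, ?_⟩ <;>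
      simp [EuclideanSpace.dist_eq, Fin.sum_univ_two]
  have ha : 0 < dist p q := dist_pos.2 hpq
  have h1 := dist_triangle p q r
  have h2 := dist_triangle q p r
  have h3 := dist_triangle p r q
  rw [dist_comm q p] at h2
  rw [dist_comm r q] at h3
  set a := dist p q
  set b := dist p r
  set c := dist q r
  have hb : 0 ≤ b := dist_nonneg
  have hc : 0 ≤ c := dist_nonneg
  -- First coordinate of `r'` when `p'` is the origin and `q'` lies on the first axis. The triangle
  -- inequalities give `|x| ≤ b`, so the height is real.
  set x := (a ^ 2 + b ^ 2 - c ^ 2) / (2 * a) with hx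
  have hxa : 2 * a * x = a ^ 2 + b ^ 2 - c ^ 2 := by rw [hx]; field_simp
  have hxb : x ^ 2 ≤ b ^ 2 := by
    apply sq_le_sq'
    · have : 0 ≤ 2 * a * (x + b) := by
        have : 2 * a * (x + b) = (a + b - c) * (a + b + c) := by linear_combination hxa
        rw [this]
        exact mul_nonneg (by linarith) (by linarith)
      nlinarith [nonneg_of_mul_nonneg_right this (by positivity)]
    · have : 0 ≤ 2 * a * (b - x) := by
        have : 2 * a * (b - x) = (c - a + b) * (c + a - b) := by linear_combination -hxa
        rw [this]
        exact mul_nonneg (by linarith) (by linarith)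
      nlinarith [nonneg_of_mul_nonneg_right this (by positivity)]
  have hy : Real.sqrt (b ^ 2 - x ^ 2) ^ 2 = b ^ 2 - x ^ 2 := Real.sq_sqrt (by linarith)
  refine ⟨0, !₂[a, 0], !₂[x, Real.sqrt (b ^ 2 - x ^ 2)], ?_, ?_, ?_⟩
  · simp [EuclideanSpace.dist_eq, Fin.sum_univ_two, Real.dist_eq, Real.sqrt_sq ha.le]
  · simp only [EuclideanSpace.dist_eq, Fin.sum_univ_two, Real.dist_eq, sq_abs]
    simp [hy, Real.sqrt_sq hb]
  · simp only [EuclideanSpace.dist_eq, Fin.sum_univ_two, Real.dist_eq, sq_abs]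
    rw [← Real.sqrt_sq hc]
    congr 1
    simp only [Matrix.cons_val_zero, Matrix.cons_val_one, zero_sub, neg_sq, hy]
    linear_combination -hxa

theorem modelAngle_eq_angle {p q r : X} {p' q' r' : EuclideanSpace ℝ (Fin 2)}
    (hpq : dist p' q' = dist p q) (hpr : dist p' r' = dist p r) (hqr : dist q' r' = dist q r) :
    modelAngle q p r = EuclideanGeometry.angle q' p' r' := by
  unfold modelAngle EuclideanGeometry.angle InnerProductGeometry.angle
  rw [vsub_eq_sub, vsub_eq_sub, inner_vsub_vsub_eq, ← dist_eq_norm, ← dist_eq_norm,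
    dist_comm q' p', dist_comm r' p', hpq, hpr, hqr]
  congr 1
  rw [div_div, mul_assoc]

theorem modelAngle_comm (p q r : X) : modelAngle q p r = modelAngle r p q := by
  unfold modelAngle
  rw [dist_comm q r]
  congr 1
  ring

theorem modelAngle_nonneg (p q r : X) : 0 ≤ modelAngle q p r := Real.arccos_nonneg _

theorem modelAngle_le_pi (p q r : X) : modelAngle q p r ≤ Real.pi := Real.arccos_le_pi _

/-- One nonzero side suffices: if `r` is `p` or `q`, the two angles with a zero side are `arccos 0 =
π / 2` and the third is `0`. -/
theorem modelAngle_sum {p q : X} (r : X) (h : q ≠ p) :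
    modelAngle p q r + modelAngle q r p + modelAngle r p q = Real.pi := by
  obtain ⟨p', q', r', h1, h2, h3⟩ := exists_model_triangle p q r
  have h1' : dist q' p' = dist q p := by rw [dist_comm, h1, dist_comm]
  have h2' : dist r' p' = dist r p := by rw [dist_comm, h2, dist_comm]
  have h3' : dist r' q' = dist r q := by rw [dist_comm, h3, dist_comm]
  rw [modelAngle_eq_angle h1' h3 h2, modelAngle_eq_angle h3' h2' h1', modelAngle_eq_angle h2 h1 h3']
  apply EuclideanGeometry.angle_add_angle_add_angle_eq_pi
  rw [← dist_pos, h1', dist_pos]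
  exact h

/-- The law of cosines for the model angle. -/
theorem dist_sq_eq_modelAngle {p q r : X} (hq : q ≠ p) (hr : r ≠ p) :
    dist q r ^ 2 = dist p q ^ 2 + dist p r ^ 2
      - 2 * dist p q * dist p r * Real.cos (modelAngle q p r) := by
  have ha : 0 < dist p q := dist_pos.2 hq.symm
  have hb : 0 < dist p r := dist_pos.2 hr.symm
  have h1 := dist_triangle p q r
  have h2 := dist_triangle q p r
  have h3 := dist_triangle p r q
  rw [dist_comm q p] at h2
  rw [dist_comm r q] at h3
  have hc : 0 ≤ dist q r := dist_nonneg
  unfold modelAngle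
  rw [Real.cos_arccos]
  · field_simp
    ring
  · rw [le_div_iff₀ (by positivity)]
    nlinarith [mul_nonneg (show 0 ≤ dist p q + dist p r - dist q r by linarith)
      (show 0 ≤ dist p q + dist p r + dist q r by linarith)]
  · rw [div_le_iff₀ (by positivity)]
    nlinarith [mul_nonneg (show 0 ≤ dist p q + dist q r - dist p r by linarith)
      (show 0 ≤ dist p r + dist q r - dist p q by linarith)]

/-! ### Geodesic segments -/

theorem IsGeodesicFromTo.dist_left {σ : ℝ → X} {x y : X} (h : IsGeodesicFromTo σ x y) {s : ℝ}
    (hs : s ∈ Set.Icc 0 (dist x y)) : dist x (σ s) = s := by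
  have := h.2.2 0 ⟨le_rfl, dist_nonneg⟩ s hs
  rw [h.1, zero_sub, abs_neg, abs_of_nonneg hs.1] at this
  exact this

theorem IsGeodesicFromTo.dist_right {σ : ℝ → X} {x y : X} (h : IsGeodesicFromTo σ x y) {s : ℝ}
    (hs : s ∈ Set.Icc 0 (dist x y)) : dist (σ s) y = dist x y - s := by
  have := h.2.2 s hs (dist x y) ⟨dist_nonneg, le_rfl⟩
  rw [h.2.1, abs_sub_comm, abs_of_nonneg (sub_nonneg.2 hs.2)] at this
  exact this

theorem IsGeodesicFromTo.mem_segment {σ : ℝ → X} {x y : X} (h : IsGeodesicFromTo σ x y) {s : ℝ}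
    (hs : s ∈ Set.Icc 0 (dist x y)) : σ s ∈ geodesicSegment x y := ⟨σ, h, s, hs, rfl⟩

theorem dist_add_dist_of_mem_segment {x y u : X} (h : u ∈ geodesicSegment x y) :
    dist x u + dist u y = dist x y := by
  obtain ⟨σ, hσ, s, hs, rfl⟩ := h
  rw [hσ.dist_left hs, hσ.dist_right hs]
  ring

theorem IsGeodesicFromTo.symm {σ : ℝ → X} {x y : X} (h : IsGeodesicFromTo σ x y) :
    IsGeodesicFromTo (fun t => σ (dist x y - t)) y x := by
  refine ⟨by simpa using h.2.1, by simpa [dist_comm y x] using h.1, fun s hs t ht => ?_⟩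
  rw [dist_comm y x] at hs ht
  rw [h.2.2 _ ⟨by linarith [hs.2], by linarith [hs.1]⟩ _ ⟨by linarith [ht.2], by linarith [ht.1]⟩,
    abs_sub_comm]
  congr 1
  ring

theorem segment_symm {x y u : X} (h : u ∈ geodesicSegment x y) : u ∈ geodesicSegment y x := by
  obtain ⟨σ, hσ, s, hs, rfl⟩ := h
  exact ⟨_, hσ.symm, dist x y - s, ⟨by linarith [hs.2], by linarith [hs.1, dist_comm x y]⟩, by simp⟩

theorem IsGeodesicFromTo.restrict {σ : ℝ → X} {x y : X} (h : IsGeodesicFromTo σ x y) {s : ℝ}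
    (hs : s ∈ Set.Icc 0 (dist x y)) : IsGeodesicFromTo σ x (σ s) := by
  refine ⟨h.1, by rw [h.dist_left hs], fun a ha b hb => ?_⟩
  rw [h.dist_left hs] at ha hb
  exact h.2.2 a ⟨ha.1, ha.2.trans hs.2⟩ b ⟨hb.1, hb.2.trans hs.2⟩

/-! ### Comparison -/

/-- The comparison inequality for two points on sides issuing from the same vertex. -/
theorem IsCAT0.dist_sq_le (hX : IsCAT0 X) {p q r u v : X} (hu : u ∈ geodesicSegment p q)
    (hv : v ∈ geodesicSegment p r) {l m : ℝ} (hl : l ∈ Set.Icc (0 : ℝ) 1)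
    (hm : m ∈ Set.Icc (0 : ℝ) 1) (hul : dist p u = l * dist p q) (hvm : dist p v = m * dist p r) :
    dist u v ^ 2 ≤ l ^ 2 * dist p q ^ 2 + m ^ 2 * dist p r ^ 2
      - l * m * (dist p q ^ 2 + dist p r ^ 2 - dist q r ^ 2) := by
  obtain ⟨p', q', r', h1, h2, h3⟩ := exists_model_triangle p q r
  have hu' := dist_add_dist_of_mem_segment hu
  have hv' := dist_add_dist_of_mem_segment hv
  have key := hX.dist_le_model p q r u v hu hv p' q' r' (AffineMap.lineMap p' q' l)
    (AffineMap.lineMap p' r' m) h1 h2 h3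
    (by rw [dist_left_lineMap, Real.norm_of_nonneg hl.1, h1, hul])
    (by rw [dist_lineMap_right, Real.norm_of_nonneg (by linarith [hl.2]), h1]; linarith)
    (by rw [dist_left_lineMap, Real.norm_of_nonneg hm.1, h2, hvm])
    (by rw [dist_lineMap_right, Real.norm_of_nonneg (by linarith [hm.2]), h2]; linarith)
  have h4 : dist (AffineMap.lineMap p' q' l) (AffineMap.lineMap p' r' m) ^ 2
      = l ^ 2 * dist p q ^ 2 + m ^ 2 * dist p r ^ 2
      - l * m * (dist p q ^ 2 + dist p r ^ 2 - dist q r ^ 2) := by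
    rw [dist_eq_norm, AffineMap.lineMap_apply, AffineMap.lineMap_apply]
    simp only [vsub_eq_sub, vadd_eq_add, add_sub_add_right_eq_sub]
    rw [norm_sub_sq_real, inner_smul_left, inner_smul_right, inner_vsub_vsub_eq, norm_smul,
      norm_smul, Real.norm_of_nonneg hl.1, Real.norm_of_nonneg hm.1, ← dist_eq_norm,
      ← dist_eq_norm, dist_comm q' p', dist_comm r' p', h1, h2, h3]
    simp only [conj_trivial]
    ring
  rw [← h4]
  gcongr

/-- Uniqueness of geodesics: in the degenerate triangle `p q q` the two comparison points coincide.
-/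
theorem IsCAT0.eq_of_mem_segment (hX : IsCAT0 X) {p q u v : X} (hu : u ∈ geodesicSegment p q)
    (hv : v ∈ geodesicSegment p q) (h : dist p u = dist p v) : u = v := by
  have hu' := dist_add_dist_of_mem_segment hu
  have hv' := dist_add_dist_of_mem_segment hv
  rcases eq_or_ne p q with rfl | hpq
  · have h1 := dist_nonneg (x := p) (y := u)
    have h2 := dist_nonneg (x := p) (y := v)
    simp only [dist_self, dist_comm u p, dist_comm v p] at hu' hv'
    rw [← dist_eq_zero.1 (show dist p u = 0 by linarith),
      ← dist_eq_zero.1 (show dist p v = 0 by linarith)]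
  have ha : 0 < dist p q := dist_pos.2 hpq
  have hl : dist p u / dist p q ∈ Set.Icc (0 : ℝ) 1 :=
    ⟨by positivity, (div_le_one ha).2 (by linarith [dist_nonneg (x := u) (y := q)])⟩
  have := hX.dist_sq_le hu hv hl hl (by field_simp) (by rw [← h]; field_simp)
  rw [dist_self] at this
  have h0 : dist u v ^ 2 ≤ 0 := this.trans (by ring_nf; rfl)
  exact dist_eq_zero.1 (pow_eq_zero_iff two_ne_zero |>.1 (le_antisymm h0 (sq_nonneg _)))

theorem IsCAT0.exists_mem_segment (hX : IsCAT0 X) {x y : X} {s : ℝ}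
    (hs : s ∈ Set.Icc 0 (dist x y)) : ∃ u ∈ geodesicSegment x y, dist x u = s := by
  obtain ⟨σ, hσ⟩ := hX.exists_geodesic x y
  exact ⟨σ s, hσ.mem_segment hs, hσ.dist_left hs⟩

theorem IsCAT0.left_mem_segment (hX : IsCAT0 X) (x y : X) : x ∈ geodesicSegment x y := by
  obtain ⟨σ, hσ⟩ := hX.exists_geodesic x y
  have := hσ.mem_segment (s := 0) ⟨le_rfl, dist_nonneg⟩
  rwa [hσ.1] at this

theorem IsCAT0.right_mem_segment (hX : IsCAT0 X) (x y : X) : y ∈ geodesicSegment x y :=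
  segment_symm (hX.left_mem_segment y x)

/-- A priori `u` and `w` lie on different geodesics; uniqueness puts `w` on the one through `u`. -/
theorem IsCAT0.mem_segment_of_dist_le (hX : IsCAT0 X) {p q u w : X}
    (hu : u ∈ geodesicSegment p q) (hw : w ∈ geodesicSegment p q) (h : dist p w ≤ dist p u) :
    w ∈ geodesicSegment p u := by
  obtain ⟨σ, hσ, s, hs, rfl⟩ := hu
  rw [hσ.dist_left hs] at h
  have hw' := dist_add_dist_of_mem_segment hw
  have ht : dist p w ∈ Set.Icc 0 (dist p q) :=
    ⟨dist_nonneg, by linarith [dist_nonneg (x := w) (y := q)]⟩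
  have : w = σ (dist p w) :=
    hX.eq_of_mem_segment hw (hσ.mem_segment ht) (hσ.dist_left ht).symm
  rw [this]
  exact (hσ.restrict hs).mem_segment ⟨ht.1, by rwa [hσ.dist_left hs]⟩

/-- Points dividing two sides issuing from a vertex in the same ratio. -/
theorem IsCAT0.dist_le_mul (hX : IsCAT0 X) {p q r u v : X} (hu : u ∈ geodesicSegment p q)
    (hv : v ∈ geodesicSegment p r) {l : ℝ} (hl : l ∈ Set.Icc (0 : ℝ) 1)
    (hul : dist p u = l * dist p q) (hvl : dist p v = l * dist p r) :
    dist u v ≤ l * dist q r := by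
  have h := hX.dist_sq_le hu hv hl hl hul hvl
  apply le_of_sq_le_sq _ (mul_nonneg hl.1 dist_nonneg)
  linarith

/-- Convexity of the metric. -/
theorem IsCAT0.dist_le_convex (hX : IsCAT0 X) {p q p' q' u v : X} (hu : u ∈ geodesicSegment p q)
    (hv : v ∈ geodesicSegment p' q') {l : ℝ} (hl : l ∈ Set.Icc (0 : ℝ) 1)
    (hul : dist p u = l * dist p q) (hvl : dist p' v = l * dist p' q') :
    dist u v ≤ (1 - l) * dist p p' + l * dist q q' := by
  have hd := dist_nonneg (x := p) (y := q')
  -- The diagonal `[p, q']` cuts the quadrilateral into triangles with apices `p` and `q'`; `w`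
  -- divides it in the same ratio.
  obtain ⟨w, hw, hwl⟩ := hX.exists_mem_segment (x := p) (y := q') (s := l * dist p q')
    ⟨mul_nonneg hl.1 hd, mul_le_of_le_one_left hd hl.2⟩
  have h1 := hX.dist_le_mul hu hw hl hul hwl
  have hw' := dist_add_dist_of_mem_segment hw
  have hv' := dist_add_dist_of_mem_segment hv
  have h2 := hX.dist_le_mul (segment_symm hw) (segment_symm hv) (l := 1 - l)
    ⟨by linarith [hl.2], by linarith [hl.1]⟩
    (by rw [dist_comm q' w, dist_comm q' p]; linarith)
    (by rw [dist_comm q' v, dist_comm q' p']; linarith)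
  linarith [dist_triangle u w v]

/-! ### Angles -/

/-- The comparison inequality, read through the law of cosines. By this monotonicity the infimum
defining `angle` is approached by all pairs near the vertex. -/
theorem IsCAT0.modelAngle_mono (hX : IsCAT0 X) {y x z u v : X} (hu : u ∈ geodesicSegment y x)
    (hv : v ∈ geodesicSegment y z) (huy : u ≠ y) (hvy : v ≠ y) :
    modelAngle u y v ≤ modelAngle x y z := by
  have hu' := dist_add_dist_of_mem_segment hu
  have hv' := dist_add_dist_of_mem_segment hv
  have hu0 : 0 < dist y u := dist_pos.2 huy.symm
  have hv0 : 0 < dist y v := dist_pos.2 hvy.symm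
  have hux := dist_nonneg (x := u) (y := x)
  have hvz := dist_nonneg (x := v) (y := z)
  have hx0 : 0 < dist y x := by linarith
  have hz0 : 0 < dist y z := by linarith
  have h := hX.dist_sq_le hu hv (l := dist y u / dist y x) (m := dist y v / dist y z)
    ⟨by positivity, (div_le_one hx0).2 (by linarith)⟩
    ⟨by positivity, (div_le_one hz0).2 (by linarith)⟩ (by field_simp) (by field_simp)
  unfold modelAngle
  apply Real.antitone_arccos
  rw [div_pow, div_pow, div_mul_cancel₀ _ (by positivity), div_mul_cancel₀ _ (by positivity)] at h
  rw [le_div_iff₀ (by positivity)]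
  calc _ = dist y u / dist y x * (dist y v / dist y z) *
        (dist y x ^ 2 + dist y z ^ 2 - dist x z ^ 2) := by field_simp
    _ ≤ _ := by linarith

theorem angle_bddBelow (x y z : X) : BddBelow {θ | ∃ u ∈ geodesicSegment y x,
    ∃ v ∈ geodesicSegment y z, u ≠ y ∧ v ≠ y ∧ θ = modelAngle u y v} :=
  ⟨0, by rintro _ ⟨u, _, v, _, _, _, rfl⟩; exact modelAngle_nonneg _ _ _⟩

theorem angle_nonneg (x y z : X) : 0 ≤ angle x y z :=
  Real.sInf_nonneg (by rintro _ ⟨u, _, v, _, _, _, rfl⟩; exact modelAngle_nonneg _ _ _)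

theorem angle_le_modelAngle_of_mem {x y z u v : X} (hu : u ∈ geodesicSegment y x)
    (hv : v ∈ geodesicSegment y z) (huy : u ≠ y) (hvy : v ≠ y) :
    angle x y z ≤ modelAngle u y v :=
  csInf_le (angle_bddBelow x y z) ⟨u, hu, v, hv, huy, hvy, rfl⟩

theorem IsCAT0.angle_le_modelAngle (hX : IsCAT0 X) {x y z : X} (hx : x ≠ y) (hz : z ≠ y) :
    angle x y z ≤ modelAngle x y z :=
  angle_le_modelAngle_of_mem (hX.right_mem_segment y x) (hX.right_mem_segment y z) hx hz

theorem angle_le_pi (x y z : X) : angle x y z ≤ Real.pi := by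
  unfold angle
  rcases Set.eq_empty_or_nonempty {θ | ∃ u ∈ geodesicSegment y x,
    ∃ v ∈ geodesicSegment y z, u ≠ y ∧ v ≠ y ∧ θ = modelAngle u y v} with h | ⟨θ, h⟩
  · rw [h, Real.sInf_empty]
    exact Real.pi_pos.le
  · refine (csInf_le (angle_bddBelow x y z) h).trans ?_
    obtain ⟨u, _, v, _, _, _, rfl⟩ := h
    exact modelAngle_le_pi _ _ _

theorem IsCAT0.angle_self_le (hX : IsCAT0 X) {x y : X} (hx : x ≠ y) : angle x y x ≤ 0 := by
  refine (hX.angle_le_modelAngle hx hx).trans ?_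
  have : 0 < dist y x := dist_pos.2 hx.symm
  unfold modelAngle
  rw [dist_self, show (dist y x ^ 2 + dist y x ^ 2 - 0 ^ 2) / (2 * dist y x * dist y x) = 1 by
    field_simp; norm_num]
  simp

theorem IsCAT0.exists_modelAngle_lt (hX : IsCAT0 X) {x y z : X} (hx : x ≠ y) (hz : z ≠ y) {α : ℝ}
    (hα : angle x y z < α) : ∃ ρ > 0, ∀ u ∈ geodesicSegment y x, ∀ v ∈ geodesicSegment y z,
      u ≠ y → v ≠ y → dist y u ≤ ρ → dist y v ≤ ρ → modelAngle u y v < α := by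
  obtain ⟨_, ⟨u, hu, v, hv, huy, hvy, rfl⟩, hlt⟩ := exists_lt_of_csInf_lt
    (s := {θ | ∃ u ∈ geodesicSegment y x, ∃ v ∈ geodesicSegment y z,
      u ≠ y ∧ v ≠ y ∧ θ = modelAngle u y v})
    ⟨_, x, hX.right_mem_segment y x, z, hX.right_mem_segment y z, hx, hz, rfl⟩ hα
  refine ⟨min (dist y u) (dist y v), lt_min (dist_pos.2 huy.symm) (dist_pos.2 hvy.symm),
    fun u' hu' v' hv' hu0 hv0 h1 h2 => lt_of_le_of_lt ?_ hlt⟩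
  exact hX.modelAngle_mono (hX.mem_segment_of_dist_le hu hu' (h1.trans (min_le_left _ _)))
    (hX.mem_segment_of_dist_le hv hv' (h2.trans (min_le_right _ _))) hu0 hv0

theorem dist_le_of_modelAngle_le {y u v : X} (hu : u ≠ y) (hv : v ≠ y) {α : ℝ}
    (hα : α ≤ Real.pi) (h : modelAngle u y v ≤ α) :
    dist u v ^ 2 ≤ dist y u ^ 2 + dist y v ^ 2 - 2 * dist y u * dist y v * Real.cos α := by
  rw [dist_sq_eq_modelAngle hu hv]
  have := Real.cos_le_cos_of_nonneg_of_le_pi (modelAngle_nonneg _ _ _) hα h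
  gcongr

/-- Take `α`, `β` slightly above the two angles on the right, with `α + β < π`. In the plane, an
isosceles triangle with apex angle `α + β` is split by a ray into angles `α` and `β`. The two parts
of its base bound `dist u m` and `dist m v`, hence the whole base bounds `dist u v`. -/
theorem IsCAT0.angle_triangle (hX : IsCAT0 X) {x y z w : X} (hx : x ≠ y) (hz : z ≠ y)
    (hw : w ≠ y) : angle x y z ≤ angle x y w + angle w y z := by
  apply le_of_forall_pos_le_add
  intro e he
  set α := angle x y w + e / 2 with hα
  set β := angle w y z + e / 2 with hβ
  have hα0 : 0 < α := by linarith [angle_nonneg x y w]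
  have hβ0 : 0 < β := by linarith [angle_nonneg w y z]
  rcases le_or_gt Real.pi (α + β) with hpi | hpi
  · linarith [angle_le_pi x y z]
  obtain ⟨ρ₁, hρ₁, H₁⟩ := hX.exists_modelAngle_lt hx hw (show angle x y w < α by linarith)
  obtain ⟨ρ₂, hρ₂, H₂⟩ := hX.exists_modelAngle_lt hw hz (show angle w y z < β by linarith)
  have hdx : 0 < dist y x := dist_pos.2 hx.symm
  have hdz : 0 < dist y z := dist_pos.2 hz.symm
  have hdw : 0 < dist y w := dist_pos.2 hw.symm
  obtain ⟨ε, hε0, hε1, hε2, hεx, hεz, hεw⟩ : ∃ ε > 0, ε ≤ ρ₁ ∧ ε ≤ ρ₂ ∧ ε ≤ dist y x ∧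
      ε ≤ dist y z ∧ ε ≤ dist y w :=
    ⟨min ρ₁ (min ρ₂ (min (dist y x) (min (dist y z) (dist y w)))), by positivity, by simp,
      by simp, by simp, by simp, by simp⟩
  set h := (α + β) / 2 with hh
  set k := (α - β) / 2 with hk
  have hcosh : 0 < Real.cos h := Real.cos_pos_of_mem_Ioo ⟨by linarith, by linarith⟩
  have hcosk : 0 < Real.cos k := Real.cos_pos_of_mem_Ioo ⟨by linarith, by linarith⟩
  have hcos : Real.cos h ≤ Real.cos k := by
    rw [← Real.cos_abs k]
    exact Real.cos_le_cos_of_nonneg_of_le_pi (abs_nonneg _) (by linarith)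
      (abs_le.2 ⟨by linarith, by linarith⟩)
  -- Distance from the apex to the point where the ray meets the base, for legs `ε`: the altitude is
  -- `ε * cos h` and makes the angle `|k|` with the ray. The base is `2 * ε * sin h`.
  set r := ε * (Real.cos h / Real.cos k) with hr
  have hr0 : 0 < r := by positivity
  have hrε : r ≤ ε := mul_le_of_le_one_right hε0.le ((div_le_one hcosk).2 hcos)
  obtain ⟨u, hu, hdu⟩ := hX.exists_mem_segment (x := y) (y := x) ⟨hε0.le, hεx⟩
  obtain ⟨v, hv, hdv⟩ := hX.exists_mem_segment (x := y) (y := z) ⟨hε0.le, hεz⟩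
  obtain ⟨m, hm, hdm⟩ := hX.exists_mem_segment (x := y) (y := w) ⟨hr0.le, hrε.trans hεw⟩
  have huy : u ≠ y := (dist_pos.1 (hdu ▸ hε0)).symm
  have hvy : v ≠ y := (dist_pos.1 (hdv ▸ hε0)).symm
  have hmy : m ≠ y := (dist_pos.1 (hdm ▸ hr0)).symm
  have A1 := H₁ u hu m hm huy hmy (hdu ▸ hε1) (hdm ▸ hrε.trans hε1)
  have A2 := H₂ m hm v hv hmy hvy (hdm ▸ hrε.trans hε2) (hdv ▸ hε2)
  have B1 := dist_le_of_modelAngle_le huy hmy (by linarith) A1.le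
  have B2 := dist_le_of_modelAngle_le hmy hvy (by linarith) A2.le
  rw [hdu, hdm] at B1
  rw [hdm, hdv] at B2
  have eα : α = h + k := by rw [hh, hk]; ring
  have eβ : β = h - k := by rw [hh, hk]; ring
  have sh := Real.sin_sq_add_cos_sq h
  have sk := Real.sin_sq_add_cos_sq k
  have hsα : 0 < Real.sin α := Real.sin_pos_of_pos_of_lt_pi hα0 (by linarith)
  have hsβ : 0 < Real.sin β := Real.sin_pos_of_pos_of_lt_pi hβ0 (by linarith)
  have C1 : dist u m ≤ ε * Real.sin α / Real.cos k := by
    apply le_of_sq_le_sq _ (by positivity)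
    refine B1.trans (le_of_eq ?_)
    rw [hr, eα, Real.sin_add, Real.cos_add]
    field_simp
    grind
  have C2 : dist m v ≤ ε * Real.sin β / Real.cos k := by
    apply le_of_sq_le_sq _ (by positivity)
    refine B2.trans (le_of_eq ?_)
    rw [hr, eβ, Real.sin_sub, Real.cos_sub]
    field_simp
    grind
  have C3 : dist u v ≤ 2 * ε * Real.sin h := by
    refine (dist_triangle u m v).trans ((add_le_add C1 C2).trans (le_of_eq ?_))
    rw [eα, eβ, Real.sin_add, Real.sin_sub]
    field_simp
    ring
  have C4 : modelAngle u y v ≤ α + β := by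
    have : α + β = Real.arccos (Real.cos (2 * h)) := by
      rw [Real.arccos_cos (by linarith) (by linarith)]
      ring
    rw [this]
    unfold modelAngle
    apply Real.antitone_arccos
    rw [hdu, hdv, le_div_iff₀ (by positivity), Real.cos_two_mul]
    have := pow_le_pow_left₀ dist_nonneg C3 2
    nlinarith
  calc angle x y z ≤ modelAngle u y v := angle_le_modelAngle_of_mem hu hv huy hvy
    _ ≤ α + β := C4
    _ = _ := by rw [hα, hβ]; ring

end Metric

section Polygon

variable {X : Type*} [MetricSpace X]

/-! ### Polygonal curves of small total rotation -/

theorem totalRotation_nonneg (n : ℕ) (v : ℕ → X) : 0 ≤ totalRotation n v :=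
  Finset.sum_nonneg fun _ _ => sub_nonneg.2 (angle_le_pi _ _ _)

theorem totalRotation_add_two (n : ℕ) (v : ℕ → X) : totalRotation (n + 2) v =
    totalRotation (n + 1) v + (Real.pi - angle (v n) (v (n + 1)) (v (n + 2))) :=
  Finset.sum_range_succ _ n

/-- A Euclidean chord is at most its arc, that is, `2 - 2 * cos θ ≤ θ ^ 2`. -/
theorem IsCAT0.dist_le_mul_modelAngle (hX : IsCAT0 X) {p q q' u v : X}
    (hu : u ∈ geodesicSegment p q) (hv : v ∈ geodesicSegment p q') (h : dist p u = dist p v) :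
    dist u v ≤ dist p u * modelAngle q p q' := by
  rcases eq_or_ne u p with rfl | hup
  · rw [dist_self] at h
    rw [← h, dist_self, zero_mul]
  have hvp : v ≠ p := by
    rw [← dist_pos, dist_comm, ← h, dist_comm, dist_pos]
    exact hup
  have hm := hX.modelAngle_mono hu hv hup hvp
  have h0 := modelAngle_nonneg p u v
  calc dist u v ≤ dist p u * modelAngle u p v := by
        apply le_of_sq_le_sq _ (mul_nonneg dist_nonneg h0)
        rw [dist_sq_eq_modelAngle hup hvp, ← h]
        nlinarith [Real.one_sub_sq_div_two_le_cos (x := modelAngle u p v), sq_nonneg (dist p u)]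
    _ ≤ _ := by gcongr

/-- If the exterior angle at `y` of the hinge `x y z` is at most `K < π / 2`, then the distance
from `x` grows at least at the rate `cos K` along `[y, z]`. -/
theorem IsCAT0.dist_add_le_of_hinge (hX : IsCAT0 X) {x y z : X} (hxy : x ≠ y) (hzy : z ≠ y) {K : ℝ}
    (hK0 : 0 ≤ K) (hK : K < Real.pi / 2) (h : Real.pi - angle x y z ≤ K) :
    dist x y + Real.cos K * dist y z ≤ dist x z := by
  have h1 := hX.angle_le_modelAngle hxy hzy
  have hc : Real.cos (modelAngle x y z) ≤ - Real.cos K := by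
    rw [← Real.cos_pi_sub]
    exact Real.cos_le_cos_of_nonneg_of_le_pi (by linarith) (modelAngle_le_pi _ _ _) (by linarith)
  apply le_of_sq_le_sq _ dist_nonneg
  rw [dist_sq_eq_modelAngle hxy hzy, dist_comm y x]
  have hab : 0 ≤ dist x y * dist y z := by positivity
  nlinarith [mul_le_mul_of_nonneg_left hc hab, sq_nonneg (dist y z), Real.cos_sq_le_one K]

/-- The four claims need each other in the induction: the angle at `v (n + 1)` between the last edge
and the chord bounds the exterior angle of the next hinge, which gives the growth of the chord and
keeps it nondegenerate. -/
theorem IsCAT0.polygon_fan (hX : IsCAT0 X) {v : ℕ → X} {K : ℝ} (hK : K < Real.pi / 2) (n : ℕ)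
    (hne : ∀ i < n + 1, v i ≠ v (i + 1)) (hrot : totalRotation (n + 1) v ≤ K) :
    v 0 ≠ v (n + 1) ∧
    angle (v n) (v (n + 1)) (v 0)
      + ∑ i ∈ Finset.range n, modelAngle (v (i + 1)) (v 0) (v (i + 2)) ≤ totalRotation (n + 1) v ∧
    Real.cos K * ∑ i ∈ Finset.range (n + 1), dist (v i) (v (i + 1)) ≤ dist (v 0) (v (n + 1)) ∧
    dist (v 0) (v n) ≤ dist (v 0) (v (n + 1)) := by
  induction n with
  | zero =>
    have h0 : v 0 ≠ v 1 := hne 0 (by simp)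
    refine ⟨h0, ?_, ?_, by simp⟩
    · simpa [totalRotation] using hX.angle_self_le h0
    · simpa using mul_le_of_le_one_left dist_nonneg (Real.cos_le_one K)
  | succ n ih =>
    rw [totalRotation_add_two] at hrot ⊢
    have hβ := angle_le_pi (v n) (v (n + 1)) (v (n + 2))
    have hK0 : 0 ≤ K := by linarith [totalRotation_nonneg (n + 1) v]
    obtain ⟨ih1, ih2, ih3, -⟩ := ih (fun i hi => hne i (by omega)) (by linarith)
    have hzy : v (n + 2) ≠ v (n + 1) := (hne (n + 1) (by omega)).symm
    have hwy : v n ≠ v (n + 1) := hne n (by omega)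
    -- The exterior angle at `v (n + 1)` of the hinge from `v 0` exceeds that of the polygon by at
    -- most the angle between the last edge and the chord.
    have htri := hX.angle_triangle hwy hzy ih1
    have hψ : 0 ≤ ∑ i ∈ Finset.range n, modelAngle (v (i + 1)) (v 0) (v (i + 2)) :=
      Finset.sum_nonneg fun _ _ => modelAngle_nonneg _ _ _
    have hinge := hX.dist_add_le_of_hinge ih1 hzy hK0 hK (by linarith)
    have hcos : 0 < Real.cos K := Real.cos_pos_of_mem_Ioo ⟨by linarith [Real.pi_pos], hK⟩
    have hxz : v 0 ≠ v (n + 2) := by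
      have : 0 < dist (v 0) (v (n + 1)) := dist_pos.2 ih1
      rw [← dist_pos]
      have : 0 ≤ Real.cos K * dist (v (n + 1)) (v (n + 2)) := by positivity
      linarith
    refine ⟨hxz, ?_, ?_, ?_⟩
    · have hsum := modelAngle_sum (v (n + 2)) ih1.symm
      have h1 := hX.angle_le_modelAngle hzy.symm hxz
      have h2 := hX.angle_le_modelAngle ih1 hzy
      rw [Finset.sum_range_succ, modelAngle_comm (v 0) (v (n + 1))]
      linarith
    · rw [Finset.sum_range_succ, mul_add]
      linarith
    · have : 0 ≤ Real.cos K * dist (v (n + 1)) (v (n + 2)) := by positivity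
      linarith

theorem totalRotation_mono {m n : ℕ} (h : m ≤ n) (v : ℕ → X) :
    totalRotation m v ≤ totalRotation n v :=
  Finset.sum_le_sum_of_subset_of_nonneg (Finset.range_mono (by omega))
    fun _ _ _ => sub_nonneg.2 (angle_le_pi _ _ _)

theorem IsCAT0.polygon_dist_mono (hX : IsCAT0 X) {v : ℕ → X} {K : ℝ} (hK : K < Real.pi / 2)
    {n : ℕ} (hne : ∀ i < n, v i ≠ v (i + 1)) (hrot : totalRotation n v ≤ K) {j k : ℕ}
    (hjk : j ≤ k) (hkn : k ≤ n) : dist (v 0) (v j) ≤ dist (v 0) (v k) := by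
  induction k, hjk using Nat.le_induction with
  | base => exact le_rfl
  | succ k hk ih =>
    exact (ih (by omega)).trans (hX.polygon_fan hK k (fun i hi => hne i (by omega))
      ((totalRotation_mono hkn v).trans hrot)).2.2.2

/-- The chord of a polygonal curve whose total rotation is at most `K < π / 2` is at least `cos K`
times its length. -/
theorem IsCAT0.polygon_chord (hX : IsCAT0 X) {v : ℕ → X} {K : ℝ} (hK : K < Real.pi / 2)
    {n : ℕ} (hne : ∀ i < n, v i ≠ v (i + 1)) (hrot : totalRotation n v ≤ K) :
    Real.cos K * ∑ i ∈ Finset.range n, dist (v i) (v (i + 1)) ≤ dist (v 0) (v n) := by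
  cases n with
  | zero => simp
  | succ n => exact (hX.polygon_fan hK n hne hrot).2.2.1

/-- A vertex of a polygonal curve of small total rotation lies close to the chord. -/
theorem IsCAT0.polygon_dist_chord (hX : IsCAT0 X) {v : ℕ → X} {K : ℝ} (hK : K < Real.pi / 2)
    {n : ℕ} (hne : ∀ i < n, v i ≠ v (i + 1)) (hrot : totalRotation n v ≤ K) {j : ℕ} (hj : 0 < j)
    (hjn : j ≤ n) {x : X} (hx : x ∈ geodesicSegment (v 0) (v n))
    (hdx : dist (v 0) x = dist (v 0) (v j)) : dist (v j) x ≤ K * dist (v 0) (v j) := by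
  obtain ⟨j, rfl⟩ : ∃ j', j = j' + 1 := ⟨j - 1, by omega⟩
  obtain ⟨n, rfl⟩ : ∃ n', n = n' + 1 := ⟨n - 1, by omega⟩
  -- Move across the fan at constant radius, from one diagonal to the next; each move costs at most
  -- the radius times an apex angle. The terms with `i < j` are harmless surplus.
  have key : ∀ k, j ≤ k → k ≤ n → ∀ x ∈ geodesicSegment (v 0) (v (k + 1)),
      dist (v 0) x = dist (v 0) (v (j + 1)) → dist (v (j + 1)) x ≤ dist (v 0) (v (j + 1)) *
        ∑ i ∈ Finset.range k, modelAngle (v (i + 1)) (v 0) (v (i + 2)) := by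
    intro k hk
    induction k, hk using Nat.le_induction with
    | base =>
      intro _ x hx hdx
      rw [hX.eq_of_mem_segment hx (hX.right_mem_segment _ _) hdx, dist_self]
      exact mul_nonneg dist_nonneg (Finset.sum_nonneg fun _ _ => modelAngle_nonneg _ _ _)
    | succ k hk ih =>
      intro hkn x hx hdx
      obtain ⟨u, hu, hdu⟩ := hX.exists_mem_segment (x := v 0) (y := v (k + 1))
        (s := dist (v 0) (v (j + 1)))
        ⟨dist_nonneg, hX.polygon_dist_mono hK hne hrot (by omega) (by omega)⟩
      have h1 := ih (by omega) u hu hdu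
      have h2 := hX.dist_le_mul_modelAngle hu hx (hdu.trans hdx.symm)
      rw [hdu] at h2
      rw [Finset.sum_range_succ, mul_add]
      linarith [dist_triangle (v (j + 1)) u x]
  refine (key n (by omega) le_rfl x hx hdx).trans ?_
  have := (hX.polygon_fan hK n hne hrot).2.1
  rw [mul_comm]
  gcongr
  linarith [angle_nonneg (v n) (v (n + 1)) (v 0)]

end Polygon

section Curve

variable {X : Type*} [MetricSpace X]

/-! ### Inscribed polygonal curves -/

/-- The polygonal curve inscribed in `γ` with the parameters `u 0, …, u n` has segments shorter
than `δ`. -/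
def IsFine (γ : ℝ → X) (δ : ℝ) (n : ℕ) (u : ℕ → ℝ) : Prop :=
  ∀ i < n, dist (γ (u i)) (γ (u (i + 1))) < δ

/-- The length of the polygonal curve inscribed in `γ` with the parameters `u 0, …, u n`. -/
noncomputable def inscribedLength (γ : ℝ → X) (n : ℕ) (u : ℕ → ℝ) : ℝ :=
  ∑ i ∈ Finset.range n, dist (γ (u i)) (γ (u (i + 1)))

/-- The concatenation of `u 0, …, u n` and `w 0, w 1, …`, where `u n = w 0`. -/
def glue (n : ℕ) (u w : ℕ → ℝ) (i : ℕ) : ℝ := if i ≤ n then u i else w (i - n)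

theorem glue_of_le {n i : ℕ} (u w : ℕ → ℝ) (h : i ≤ n) : glue n u w i = u i := if_pos h

theorem glue_add {n : ℕ} {u w : ℕ → ℝ} (h : u n = w 0) (i : ℕ) : glue n u w (n + i) = w i := by
  unfold glue
  rcases Nat.eq_zero_or_pos i with rfl | hi
  · simp [h]
  · rw [if_neg (by omega), Nat.add_sub_cancel_left]

variable {γ : ℝ → X} {a b c δ : ℝ} {n m : ℕ} {u w : ℕ → ℝ}

theorem glue_forall {P : ℝ → ℝ → Prop} (h : u n = w 0) (hu : ∀ i < n, P (u i) (u (i + 1)))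
    (hw : ∀ i < m, P (w i) (w (i + 1))) :
    ∀ i < n + m, P (glue n u w i) (glue n u w (i + 1)) := by
  intro i hi
  rcases lt_or_ge i n with h' | h'
  · rw [glue_of_le _ _ h'.le, glue_of_le _ _ h']
    exact hu i h'
  · obtain ⟨j, rfl⟩ := Nat.exists_eq_add_of_le h'
    rw [add_assoc, glue_add h, glue_add h]
    exact hw j (by omega)

theorem IsInscribed.glue (hu : IsInscribed γ a b n u) (hw : IsInscribed γ b c m w) :
    IsInscribed γ a c (n + m) (glue n u w) := by
  have h : u n = w 0 := hu.last.trans hw.first.symm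
  exact ⟨by rw [glue_of_le _ _ (Nat.zero_le n), hu.first], by rw [glue_add h, hw.last],
    glue_forall (P := fun x y => x < y) h hu.lt_succ hw.lt_succ,
    glue_forall (P := fun x y => γ x ≠ γ y) h hu.ne_succ hw.ne_succ⟩

theorem IsFine.glue (h : u n = w 0) (hu : IsFine γ δ n u) (hw : IsFine γ δ m w) :
    IsFine γ δ (n + m) (glue n u w) :=
  glue_forall (P := fun x y => dist (γ x) (γ y) < δ) h hu hw

theorem inscribedLength_glue (h : u n = w 0) : inscribedLength γ (n + m) (glue n u w) =
    inscribedLength γ n u + inscribedLength γ m w := by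
  unfold inscribedLength
  rw [Finset.sum_range_add]
  congr 1
  · refine Finset.sum_congr rfl fun i hi => ?_
    rw [Finset.mem_range] at hi
    rw [glue_of_le _ _ hi.le, glue_of_le _ _ hi]
  · refine Finset.sum_congr rfl fun i _ => ?_
    rw [add_assoc, glue_add h, glue_add h]

/-- Only an inequality: the rotation at the joint is nonnegative and belongs to neither part. -/
theorem totalRotation_glue (h : u n = w 0) :
    totalRotation n (fun i => γ (u i)) + totalRotation m (fun i => γ (w i)) ≤
      totalRotation (n + m) (fun i => γ (glue n u w i)) := by
  have h1 : totalRotation n (fun i => γ (u i)) =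
      totalRotation n (fun i => γ (glue n u w i)) := by
    refine Finset.sum_congr rfl fun i hi => ?_
    rw [Finset.mem_range] at hi
    simp only
    rw [glue_of_le _ _ (by omega), glue_of_le _ _ (by omega), glue_of_le _ _ (by omega)]
  rw [h1]
  cases m with
  | zero => simp [totalRotation]
  | succ m =>
    have h2 : totalRotation (n + (m + 1)) (fun i => γ (glue n u w i)) =
        totalRotation (n + 1) (fun i => γ (glue n u w i)) +
          totalRotation (m + 1) (fun i => γ (w i)) := by
      refine (Finset.sum_range_add _ n m).trans ?_
      congr 1
      refine Finset.sum_congr rfl fun i _ => ?_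
      simp only
      rw [add_assoc, add_assoc, glue_add h, glue_add h, glue_add h]
    rw [h2]
    gcongr
    exact totalRotation_mono (Nat.le_succ n) _

theorem isInscribed_single (hab : a < b) (h : γ a ≠ γ b) :
    IsInscribed γ a b 1 (fun i => if i = 0 then a else b) :=
  ⟨by simp, by simp, by simpa using hab, by simpa using h⟩

/-- Removing the degenerate segments of an inscribed polygonal curve. -/
theorem exists_isInscribed_of_le (n : ℕ) (hw : ∀ i < n, w i ≤ w (i + 1)) (hf : IsFine γ δ n w) :
    inscribedLength γ n w = 0 ∨ ∃ m u, IsInscribed γ (w 0) (w n) m u ∧ IsFine γ δ m u ∧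
      inscribedLength γ m u = inscribedLength γ n w := by
  induction n with
  | zero => exact Or.inl (by simp [inscribedLength])
  | succ n ih =>
    have hlen : inscribedLength γ (n + 1) w =
        inscribedLength γ n w + dist (γ (w n)) (γ (w (n + 1))) := Finset.sum_range_succ _ n
    have hn := hw n (by omega)
    have ih' := ih (fun i hi => hw i (by omega)) (fun i hi => hf i (by omega))
    rcases eq_or_ne (γ (w n)) (γ (w (n + 1))) with heq | hne
    · rw [heq, dist_self, add_zero] at hlen
      rw [hlen]
      rcases ih' with h0 | ⟨m, u, hu, huf, hul⟩
      · exact Or.inl h0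
      rcases Nat.eq_zero_or_pos m with rfl | hm
      · exact Or.inl (by rw [← hul]; simp [inscribedLength])
      right
      -- Moving the last parameter to `w (n + 1)` does not change the vertices.
      have hγ : ∀ i ≤ m, γ (Function.update u m (w (n + 1)) i) = γ (u i) := by
        intro i _
        rcases eq_or_ne i m with rfl | him
        · simp [hu.last, heq]
        · simp [him]
      refine ⟨m, Function.update u m (w (n + 1)), ⟨?_, by simp, ?_, ?_⟩, ?_, ?_⟩
      · simpa [hm.ne] using hu.first
      · intro i hi
        rw [Function.update_of_ne hi.ne]
        refine (hu.lt_succ i hi).trans_le ?_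
        rcases eq_or_ne (i + 1) m with him | him
        · rw [him, Function.update_self, hu.last]
          exact hn
        · rw [Function.update_of_ne him]
      · intro i hi
        rw [hγ i hi.le, hγ (i + 1) hi]
        exact hu.ne_succ i hi
      · intro i hi
        rw [hγ i hi.le, hγ (i + 1) hi]
        exact huf i hi
      · rw [← hul]
        refine Finset.sum_congr rfl fun i hi => ?_
        rw [Finset.mem_range] at hi
        rw [hγ i hi.le, hγ (i + 1) hi]
    · right
      have hlt : w n < w (n + 1) := lt_of_le_of_ne hn fun h => hne (by rw [h])
      rcases ih' with h0 | ⟨m, u, hu, huf, hul⟩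
      -- Zero length so far: the single segment from `w 0` to `w (n + 1)` replaces everything.
      · have h0' : γ (w 0) = γ (w n) := by
          have := dist_le_range_sum_dist (fun i => γ (w i)) n
          exact dist_le_zero.1 (this.trans h0.le)
        have hle : w 0 ≤ w n := by
          have : ∀ k ≤ n, w 0 ≤ w k := by
            intro k
            induction k with
            | zero => simp
            | succ k ihk => exact fun hk => (ihk (by omega)).trans (hw k (by omega))
          exact this n le_rfl
        refine ⟨1, _, isInscribed_single (hle.trans_lt hlt) (by rwa [h0']), ?_, ?_⟩
        · intro i hi
          obtain rfl : i = 0 := by omega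
          simpa [h0'] using hf n (by omega)
        · rw [hlen, h0]
          simp [inscribedLength, h0']
      · have hs := isInscribed_single hlt hne
        have hj : u m = (fun i : ℕ => if i = 0 then w n else w (n + 1)) 0 := by simp [hu.last]
        refine ⟨m + 1, _, hu.glue hs, huf.glue hj ?_, ?_⟩
        · intro i hi
          obtain rfl : i = 0 := by omega
          simpa using hf n (by omega)
        · rw [inscribedLength_glue hj, hul, hlen]
          simp [inscribedLength]

/-! ### Curves parametrized by arclength -/

theorem dist_le_of_hasUnitSpeedOn (hγ : HasUnitSpeedOn γ (Set.Ici 0)) (ha : 0 ≤ a) (hab : a ≤ b) :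
    dist (γ a) (γ b) ≤ b - a := by
  have h := hγ (show a ∈ Set.Ici 0 from ha) (show b ∈ Set.Ici 0 from ha.trans hab)
  have h' := eVariationOn.edist_le γ (s := Set.Ici 0 ∩ Set.Icc a b) (x := a) (y := b)
    ⟨ha, le_rfl, hab⟩ ⟨ha.trans hab, hab, le_rfl⟩
  rw [h, edist_dist] at h'
  simpa using (ENNReal.ofReal_le_ofReal_iff (by simpa using hab)).1 h'

theorem exists_isInscribed_of_lt (hγ : HasUnitSpeedOn γ (Set.Ici 0)) (ha : 0 ≤ a) (hab : a < b)
    (hδ : b - a < δ) {ε : ℝ} (hε : 0 < ε) :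
    ∃ n u, IsInscribed γ a b n u ∧ IsFine γ δ n u ∧ b - a - ε ≤ inscribedLength γ n u := by
  -- The bound by `(b - a) / 2` keeps the polygon's length positive, which excludes the zero-length
  -- alternative at the end.
  set η := min ε ((b - a) / 2) with hη
  have hη0 : 0 < η := lt_min hε (by linarith)
  have hη1 : η ≤ ε := min_le_left _ _
  have hη2 : η ≤ (b - a) / 2 := min_le_right _ _
  have h := hγ (show a ∈ Set.Ici 0 from ha) (show b ∈ Set.Ici 0 from ha.trans hab.le)
  have hlt : ENNReal.ofReal (b - a - η) < eVariationOn γ (Set.Ici 0 ∩ Set.Icc a b) := by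
    rw [h]
    exact (ENNReal.ofReal_lt_ofReal_iff (by simpa using hab)).2 (by simpa using hη0)
  obtain ⟨⟨n, v, hv, hvm⟩, hsum⟩ := lt_iSup_iff.1 hlt
  simp only [edist_dist] at hsum
  rw [← ENNReal.ofReal_sum_of_nonneg fun _ _ => dist_nonneg] at hsum
  have hsum' := (ENNReal.ofReal_lt_ofReal_iff_of_nonneg (by linarith)).1 hsum
  -- The partition that nearly attains the variation need not contain `a` and `b`; adding them
  -- cannot shorten the polygon.
  let w : ℕ → ℝ := fun i => if i = 0 then a else if i ≤ n + 1 then v (i - 1) else b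
  have hw0 : w 0 = a := by simp [w]
  have hwn : w (n + 2) = b := by simp [w]
  have hwi : ∀ i ≤ n, w (i + 1) = v i := fun i hi => by simp [w, hi]
  have hwm : ∀ i, w i ∈ Set.Icc a b := by
    intro i
    simp only [w]
    split_ifs
    · exact ⟨le_rfl, hab.le⟩
    · exact (hvm _).2
    · exact ⟨hab.le, le_rfl⟩
  have hwle : ∀ i < n + 2, w i ≤ w (i + 1) := by
    intro i hi
    rcases Nat.eq_zero_or_pos i with rfl | hi0
    · rw [hw0]
      exact (hwm _).1
    rcases eq_or_ne i (n + 1) with rfl | hin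
    · rw [hwn]
      exact (hwm _).2
    · obtain ⟨j, rfl⟩ : ∃ j, i = j + 1 := ⟨i - 1, by omega⟩
      rw [hwi j (by omega), hwi (j + 1) (by omega)]
      exact hv (Nat.le_succ j)
  have hfine : IsFine γ δ (n + 2) w := fun i hi =>
    (dist_le_of_hasUnitSpeedOn hγ (ha.trans (hwm i).1) (hwle i hi)).trans_lt
      (by linarith [(hwm i).1, (hwm (i + 1)).2])
  have hlen : b - a - η ≤ inscribedLength γ (n + 2) w := by
    unfold inscribedLength
    rw [Finset.sum_range_succ, Finset.sum_range_succ']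
    have : ∑ i ∈ Finset.range n, dist (γ (v (i + 1))) (γ (v i)) =
        ∑ i ∈ Finset.range n, dist (γ (w (i + 1))) (γ (w (i + 1 + 1))) := by
      refine Finset.sum_congr rfl fun i hi => ?_
      rw [Finset.mem_range] at hi
      rw [hwi i (by omega), hwi (i + 1) (by omega), dist_comm]
    rw [← this]
    have h1 := dist_nonneg (x := γ (w 0)) (y := γ (w (0 + 1)))
    have h2 := dist_nonneg (x := γ (w (n + 1))) (y := γ (w (n + 1 + 1)))
    linarith
  rcases exists_isInscribed_of_le (n + 2) hwle hfine with h0 | ⟨m, u, hu, huf, hul⟩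
  · linarith
  · rw [hw0, hwn] at hu
    exact ⟨m, u, hu, huf, by linarith⟩

/-- A curve parametrized by arclength has inscribed polygonal curves with short segments whose
length is close to that of the curve. -/
theorem exists_isInscribed (hγ : HasUnitSpeedOn γ (Set.Ici 0)) (ha : 0 ≤ a) (hab : a < b)
    (hδ : 0 < δ) {ε : ℝ} (hε : 0 < ε) :
    ∃ n u, IsInscribed γ a b n u ∧ IsFine γ δ n u ∧ b - a - ε ≤ inscribedLength γ n u := by
  -- On an interval shorter than `δ` every partition is fine, so `[a, b]` is cut into `N + 1` such
  -- pieces that share the error `ε`.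
  have key : ∀ h η : ℝ, 0 < h → h < δ → 0 < η → ∀ N : ℕ, ∃ n u,
      IsInscribed γ a (a + (N + 1) * h) n u ∧ IsFine γ δ n u ∧
        (N + 1) * (h - η) ≤ inscribedLength γ n u := by
    intro h η hh hhδ hη N
    induction N with
    | zero =>
      obtain ⟨n, u, h1, h2, h3⟩ := exists_isInscribed_of_lt hγ ha (b := a + h) (by linarith)
        (by simpa using hhδ) hη
      exact ⟨n, u, by simpa using h1, h2, by simpa using h3⟩
    | succ N ih =>
      obtain ⟨n, u, h1, h2, h3⟩ := ih
      obtain ⟨m, w, h1', h2', h3'⟩ := exists_isInscribed_of_lt hγ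
        (a := a + (N + 1) * h) (b := a + (N + 1) * h + h) (by positivity) (by linarith)
        (by simpa using hhδ) hη
      have hj : u n = w 0 := h1.last.trans h1'.first.symm
      refine ⟨n + m, _, ?_, h2.glue hj h2', ?_⟩
      · have := h1.glue h1'
        convert this using 1
        push_cast
        ring
      · rw [inscribedLength_glue hj]
        push_cast
        linarith
  obtain ⟨N, hN⟩ := exists_nat_gt ((b - a) / δ)
  have hN' : (0 : ℝ) < N + 1 := by positivity
  obtain ⟨n, u, h1, h2, h3⟩ := key ((b - a) / (N + 1)) (ε / (N + 1))
    (div_pos (by linarith) hN') (by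
      rw [div_lt_iff₀ hδ] at hN
      rw [div_lt_iff₀ hN']
      linarith) (by positivity) N
  rw [mul_div_cancel₀ _ hN'.ne', add_sub_cancel] at h1
  refine ⟨n, u, h1, h2, le_trans (le_of_eq ?_) h3⟩
  field_simp

/-! ### Total curvature -/

theorem totalCurvature_superadditive (hγ : HasUnitSpeedOn γ (Set.Ici 0)) (ha : 0 ≤ a)
    (hab : a < b) (hbc : b < c) :
    totalCurvature γ a b + totalCurvature γ b c ≤ totalCurvature γ a c := by
  conv_rhs => unfold totalCurvature
  refine le_iInf₂ fun δ hδ => ?_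
  refine (add_le_add (iInf₂_le (i := δ) hδ) (iInf₂_le (i := δ) hδ)).trans ?_
  set T : ℝ≥0∞ := ⨆ (n : ℕ) (u : ℕ → ℝ) (_ : IsInscribed γ a c n u)
    (_ : ∀ i < n, dist (γ (u i)) (γ (u (i + 1))) < δ),
    ENNReal.ofReal (totalRotation n fun i => γ (u i)) with hT
  have key : ∀ n u m w, IsInscribed γ a b n u → IsFine γ δ n u → IsInscribed γ b c m w →
      IsFine γ δ m w → ENNReal.ofReal (totalRotation n fun i => γ (u i)) +
        ENNReal.ofReal (totalRotation m fun i => γ (w i)) ≤ T := by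
    intro n u m w hu huf hw hwf
    have hj : u n = w 0 := hu.last.trans hw.first.symm
    rw [← ENNReal.ofReal_add (totalRotation_nonneg _ _) (totalRotation_nonneg _ _)]
    refine (ENNReal.ofReal_le_ofReal (totalRotation_glue hj)).trans ?_
    exact le_iSup_of_le (n + m) (le_iSup_of_le (glue n u w) (le_iSup_of_le (hu.glue hw)
      (le_iSup_of_le (huf.glue hj hwf) le_rfl)))
  -- Passing to the two suprema one at a time uses truncated subtraction from `T`. These polygons
  -- show that the subtracted terms are at most `T`.
  obtain ⟨n₀, u₀, hu₀, huf₀, -⟩ := exists_isInscribed hγ ha hab hδ one_pos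
  obtain ⟨m₀, w₀, hw₀, hwf₀, -⟩ := exists_isInscribed hγ (ha.trans hab.le) hbc hδ one_pos
  have key' : ∀ m w, IsInscribed γ b c m w → IsFine γ δ m w →
      (⨆ (n : ℕ) (u : ℕ → ℝ) (_ : IsInscribed γ a b n u)
        (_ : ∀ i < n, dist (γ (u i)) (γ (u (i + 1))) < δ),
        ENNReal.ofReal (totalRotation n fun i => γ (u i))) +
          ENNReal.ofReal (totalRotation m fun i => γ (w i)) ≤ T := by
    intro m w hw hwf
    have hle : ENNReal.ofReal (totalRotation m fun i => γ (w i)) ≤ T :=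
      le_add_self.trans (key n₀ u₀ m w hu₀ huf₀ hw hwf)
    refine (add_le_add_left (c := T - ENNReal.ofReal (totalRotation m fun i => γ (w i))) ?_ _).trans
      (tsub_add_cancel_of_le hle).le
    exact iSup_le fun n => iSup_le fun u => iSup_le fun hu => iSup_le fun huf =>
      ENNReal.le_sub_of_add_le_right ENNReal.ofReal_ne_top (key n u m w hu huf hw hwf)
  set S : ℝ≥0∞ := ⨆ (n : ℕ) (u : ℕ → ℝ) (_ : IsInscribed γ a b n u)
        (_ : ∀ i < n, dist (γ (u i)) (γ (u (i + 1))) < δ),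
        ENNReal.ofReal (totalRotation n fun i => γ (u i)) with hS
  rcases eq_or_ne T ⊤ with hTt | hTt
  · rw [hTt]
    exact le_top
  have hST : S ≤ T := le_self_add.trans (key' m₀ w₀ hw₀ hwf₀)
  have hSt : S ≠ ⊤ := ne_top_of_le_ne_top hTt hST
  refine (add_le_add_right (c := T - S) ?_ _).trans (add_tsub_cancel_of_le hST).le
  exact iSup_le fun m => iSup_le fun w => iSup_le fun hw => iSup_le fun hwf =>
    ENNReal.le_sub_of_add_le_left hSt (key' m w hw hwf)

theorem exists_totalRotation_le {K : ℝ} (h : totalCurvature γ a b < ENNReal.ofReal K) :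
    ∃ δ > 0, ∀ n u, IsInscribed γ a b n u → IsFine γ δ n u →
      totalRotation n (fun i => γ (u i)) ≤ K := by
  unfold totalCurvature at h
  obtain ⟨δ, h⟩ := iInf_lt_iff.1 h
  obtain ⟨hδ, h⟩ := iInf_lt_iff.1 h
  refine ⟨δ, hδ, fun n u hu huf => ?_⟩
  have hK : 0 < K := ENNReal.ofReal_pos.1 (bot_le.trans_lt h)
  refine (ENNReal.ofReal_le_ofReal_iff hK.le).1 (le_trans ?_ h.le)
  exact le_iSup_of_le n (le_iSup_of_le u (le_iSup_of_le hu (le_iSup_of_le huf le_rfl)))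

/-! ### Chords of curves of small total curvature -/

theorem IsCAT0.curve_chord (hX : IsCAT0 X) (hγ : HasUnitSpeedOn γ (Set.Ici 0)) (ha : 0 ≤ a)
    (hab : a ≤ b) {K : ℝ} (hK : K < Real.pi / 2)
    (h : totalCurvature γ a b < ENNReal.ofReal K) :
    Real.cos K * (b - a) ≤ dist (γ a) (γ b) := by
  rcases hab.eq_or_lt with rfl | hab
  · simp
  have hK0 : 0 < K := ENNReal.ofReal_pos.1 (bot_le.trans_lt h)
  have hcos : 0 < Real.cos K := Real.cos_pos_of_mem_Ioo ⟨by linarith [Real.pi_pos], hK⟩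
  obtain ⟨δ, hδ, H⟩ := exists_totalRotation_le h
  apply le_of_forall_pos_le_add
  intro ε hε
  obtain ⟨n, u, hu, huf, hul⟩ := exists_isInscribed hγ ha hab hδ (div_pos hε hcos)
  have := hX.polygon_chord hK hu.ne_succ (H n u hu huf)
  rw [hu.first, hu.last] at this
  have h2 := mul_le_mul_of_nonneg_left hul hcos.le
  rw [mul_sub, mul_div_cancel₀ _ hcos.ne'] at h2
  change Real.cos K * inscribedLength γ n u ≤ _ at this
  linarith

/-- Gluing polygons over `[a, b]` and `[b, c]` makes `γ b` a vertex. -/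
theorem IsCAT0.curve_dist_chord (hX : IsCAT0 X) (hγ : HasUnitSpeedOn γ (Set.Ici 0)) (ha : 0 ≤ a)
    (hab : a < b) (hbc : b < c) {K : ℝ} (hK : K < Real.pi / 2)
    (h : totalCurvature γ a c < ENNReal.ofReal K) :
    dist (γ a) (γ b) ≤ dist (γ a) (γ c) ∧ ∀ x ∈ geodesicSegment (γ a) (γ c),
      dist (γ a) x = dist (γ a) (γ b) → dist (γ b) x ≤ K * dist (γ a) (γ b) := by
  obtain ⟨δ, hδ, H⟩ := exists_totalRotation_le h
  obtain ⟨n, u, hu, huf, -⟩ := exists_isInscribed hγ ha hab hδ one_pos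
  obtain ⟨m, w, hw, hwf, -⟩ := exists_isInscribed hγ (ha.trans hab.le) hbc hδ one_pos
  have hj : u n = w 0 := hu.last.trans hw.first.symm
  have hg := hu.glue hw
  have hrot := H _ _ hg (huf.glue hj hwf)
  have hn : 0 < n := by
    rcases Nat.eq_zero_or_pos n with rfl | hn
    · exact absurd (hu.first.symm.trans hu.last) hab.ne
    · exact hn
  have e0 := hg.first
  have en : glue n u w n = b := (glue_of_le _ _ le_rfl).trans hu.last
  have ec := hg.last
  constructor
  · have := hX.polygon_dist_mono hK hg.ne_succ hrot (Nat.le_add_right n m) le_rfl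
    simpa only [e0, en, ec] using this
  · intro x hx hdx
    have := hX.polygon_dist_chord hK hg.ne_succ hrot hn (Nat.le_add_right n m) (x := x)
      (by simpa only [e0, ec] using hx) (by simpa only [e0, en] using hdx)
    simpa only [e0, en] using this

end Curve

section FiniteTotalCurvature

open Filter

variable {X : Type*} [MetricSpace X] {γ : ℝ → X} {τγ : ℝ≥0}

/-! ### Curves of finite total curvature -/

theorem totalCurvature_mono (hγ : HasUnitSpeedOn γ (Set.Ici 0)) {s t : ℝ} (hs : 0 < s)
    (hst : s ≤ t) : totalCurvature γ 0 s ≤ totalCurvature γ 0 t := by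
  rcases hst.eq_or_lt with rfl | hst
  · exact le_rfl
  · exact le_self_add.trans (totalCurvature_superadditive hγ le_rfl hs hst)

theorem totalCurvature_le_tail (hγ : HasUnitSpeedOn γ (Set.Ici 0))
    (hτ : Tendsto (fun t : ℝ => totalCurvature γ 0 t) atTop (𝓝 (τγ : ℝ≥0∞))) {s t : ℝ}
    (hs : 0 < s) (hst : s < t) :
    totalCurvature γ s t ≤ (τγ : ℝ≥0∞) - totalCurvature γ 0 s := by
  have h1 : totalCurvature γ 0 t ≤ τγ := by
    refine ge_of_tendsto hτ ?_
    filter_upwards [eventually_ge_atTop t] with t' ht'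
    exact totalCurvature_mono hγ (hs.trans hst) ht'
  have h2 := (totalCurvature_superadditive hγ le_rfl hs hst).trans h1
  refine ENNReal.le_sub_of_add_le_left ?_ h2
  exact ne_top_of_le_ne_top ENNReal.coe_ne_top (le_self_add.trans h2)

theorem tendsto_tail (hτ : Tendsto (fun t : ℝ => totalCurvature γ 0 t) atTop (𝓝 (τγ : ℝ≥0∞))) :
    Tendsto (fun t : ℝ => (τγ : ℝ≥0∞) - totalCurvature γ 0 t) atTop (𝓝 0) := by
  have := ENNReal.Tendsto.sub (tendsto_const_nhds (x := (τγ : ℝ≥0∞))) hτ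
    (Or.inl ENNReal.coe_ne_top)
  rwa [tsub_self] at this

theorem exists_totalCurvature_lt (hγ : HasUnitSpeedOn γ (Set.Ici 0))
    (hτ : Tendsto (fun t : ℝ => totalCurvature γ 0 t) atTop (𝓝 (τγ : ℝ≥0∞))) {K : ℝ}
    (hK : 0 < K) : ∃ s > 0, ∀ t > s, totalCurvature γ s t < ENNReal.ofReal K := by
  have h := (tendsto_tail hτ).eventually (gt_mem_nhds (ENNReal.ofReal_pos.2 hK))
  obtain ⟨s, hs, hs0⟩ := (h.and (eventually_gt_atTop 0)).exists
  exact ⟨s, hs0, fun t ht => (totalCurvature_le_tail hγ hτ hs0 ht).trans_lt hs⟩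

theorem one_lt_pi_div_two : (1 : ℝ) < Real.pi / 2 := by linarith [Real.pi_gt_three]

theorem IsCAT0.isBigO_dist (hX : IsCAT0 X) (hγ : HasUnitSpeedOn γ (Set.Ici 0))
    (hτ : Tendsto (fun t : ℝ => totalCurvature γ 0 t) atTop (𝓝 (τγ : ℝ≥0∞))) (p : X) :
    (fun t : ℝ => t) =O[atTop] fun t => dist p (γ t) := by
  obtain ⟨s, hs, H⟩ := exists_totalCurvature_lt hγ hτ one_pos
  have hc : 0 < Real.cos 1 := Real.cos_one_pos
  -- The chord estimate gives `cos 1 * (t - s) ≤ dist p (γ s) + dist p (γ t)`; for large `t`, half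
  -- of `cos 1 * t` absorbs the constants.
  refine Asymptotics.IsBigO.of_bound (2 / Real.cos 1) ?_
  filter_upwards [eventually_gt_atTop s,
    eventually_ge_atTop (2 * (Real.cos 1 * s + dist p (γ s)) / Real.cos 1)] with t ht ht'
  have h1 := hX.curve_chord hγ hs.le ht.le one_lt_pi_div_two (H t ht)
  have h2 := dist_triangle (γ s) p (γ t)
  rw [dist_comm (γ s) p] at h2
  rw [div_le_iff₀ hc] at ht'
  rw [Real.norm_of_nonneg (hs.trans ht).le, Real.norm_of_nonneg dist_nonneg, div_mul_eq_mul_div,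
    le_div_iff₀ hc]
  nlinarith

theorem IsCAT0.tendsto_dist (hX : IsCAT0 X) (hγ : HasUnitSpeedOn γ (Set.Ici 0))
    (hτ : Tendsto (fun t : ℝ => totalCurvature γ 0 t) atTop (𝓝 (τγ : ℝ≥0∞))) (p : X) :
    Tendsto (fun t => dist p (γ t)) atTop atTop := by
  obtain ⟨C, hC, h⟩ := (hX.isBigO_dist hγ hτ p).exists_pos
  refine tendsto_atTop_mono' atTop ?_ (tendsto_id.atTop_div_const hC)
  filter_upwards [h.bound] with t ht
  rw [Real.norm_of_nonneg dist_nonneg] at ht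
  rw [id, div_le_iff₀' hC]
  exact (Real.le_norm_self t).trans ht

theorem dist_le_circumradius (hγ : HasUnitSpeedOn γ (Set.Ici 0)) {t : ℝ} (ht : 0 ≤ t) :
    dist (γ 0) (γ t) ≤ circumradius γ t := by
  refine le_csInf ⟨t, ?_⟩ fun r hr => ?_
  · rintro _ ⟨s, hs, rfl⟩
    rw [Metric.mem_closedBall, dist_comm]
    have := dist_le_of_hasUnitSpeedOn hγ le_rfl hs.1
    linarith [hs.2]
  · have := hr ⟨t, ⟨ht, le_rfl⟩, rfl⟩
    rwa [Metric.mem_closedBall, dist_comm] at this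

theorem IsCAT0.isBigO_circumradius (hX : IsCAT0 X) (hγ : HasUnitSpeedOn γ (Set.Ici 0))
    (hτ : Tendsto (fun t : ℝ => totalCurvature γ 0 t) atTop (𝓝 (τγ : ℝ≥0∞))) :
    (fun t : ℝ => t) =O[atTop] circumradius γ := by
  refine (hX.isBigO_dist hγ hτ (γ 0)).trans (Asymptotics.IsBigO.of_bound 1 ?_)
  filter_upwards [eventually_ge_atTop 0] with t ht
  rw [one_mul, Real.norm_of_nonneg dist_nonneg]
  exact (dist_le_circumradius hγ ht).trans (Real.le_norm_self _)

/-! ### The asymptotic ray -/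

theorem IsCAT0.dist_of_mem_segment (hX : IsCAT0 X) {p q u v : X} (hu : u ∈ geodesicSegment p q)
    (hv : v ∈ geodesicSegment p q) : dist u v = |dist p u - dist p v| := by
  rcases le_total (dist p u) (dist p v) with h | h
  · have := dist_add_dist_of_mem_segment (hX.mem_segment_of_dist_le hv hu h)
    rw [abs_sub_comm, abs_of_nonneg (sub_nonneg.2 h)]
    linarith
  · have := dist_add_dist_of_mem_segment (hX.mem_segment_of_dist_le hu hv h)
    rw [abs_of_nonneg (sub_nonneg.2 h), dist_comm u v]
    linarith

/-- Convexity carries the point `y` of the chord `[γ s, γ t']` near `γ t` to a point `z` of `[p, γ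
t']`, at cost at most `dist p (γ s)`. As `x` has the same distance from `p` as `γ t`, it is no
farther from `z` than `γ t` is; hence the factor `2`. -/
theorem IsCAT0.dist_le_of_chord (hX : IsCAT0 X) (hγ : HasUnitSpeedOn γ (Set.Ici 0)) (p : X)
    {s t t' K : ℝ} (hs : 0 ≤ s) (hst : s < t) (htt' : t < t') (hK : K < Real.pi / 2)
    (h : totalCurvature γ s t' < ENNReal.ofReal K) {x : X} (hx : x ∈ geodesicSegment p (γ t'))
    (hdx : dist p x = dist p (γ t)) :
    dist (γ t) x ≤ 2 * (K * dist (γ s) (γ t) + dist p (γ s)) := by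
  obtain ⟨hle, hchord⟩ := hX.curve_dist_chord hγ hs hst htt' hK h
  obtain ⟨y, hy, hdy⟩ := hX.exists_mem_segment ⟨dist_nonneg, hle⟩
  have h1 := hchord y hy hdy
  set l := dist (γ s) y / dist (γ s) (γ t') with hl
  have hl01 : l ∈ Set.Icc (0 : ℝ) 1 :=
    ⟨by positivity, div_le_one_of_le₀ (hdy.trans_le hle) dist_nonneg⟩
  have hdyl : dist (γ s) y = l * dist (γ s) (γ t') := by
    rcases eq_or_ne (dist (γ s) (γ t')) 0 with h0 | h0
    · rw [h0, mul_zero]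
      exact le_antisymm (by rw [hdy, ← h0]; exact hle) dist_nonneg
    · rw [hl, div_mul_cancel₀ _ h0]
  have hd := dist_nonneg (x := p) (y := γ t')
  obtain ⟨z, hz, hdz⟩ := hX.exists_mem_segment (x := p) (y := γ t') (s := l * dist p (γ t'))
    ⟨mul_nonneg hl01.1 hd, mul_le_of_le_one_left hd hl01.2⟩
  have h2 := hX.dist_le_convex hy hz hl01 hdyl hdz
  rw [dist_self, mul_zero, add_zero, dist_comm (γ s) p] at h2
  have h3 : dist y z ≤ dist p (γ s) :=
    h2.trans (mul_le_of_le_one_left dist_nonneg (by linarith [hl01.1]))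
  have h4 := dist_triangle (γ t) y z
  have h5 := hX.dist_of_mem_segment hx hz
  have h6 := abs_dist_sub_le (γ t) z p
  rw [hdx, dist_comm p, dist_comm p] at h5
  have h7 := dist_triangle (γ t) z x
  rw [dist_comm z x] at h7
  linarith

theorem IsCAT0.exists_dist_le_mul (hX : IsCAT0 X) (hγ : HasUnitSpeedOn γ (Set.Ici 0))
    (hτ : Tendsto (fun t : ℝ => totalCurvature γ 0 t) atTop (𝓝 (τγ : ℝ≥0∞))) (p : X) {ε : ℝ}
    (hε : 0 < ε) : ∀ᶠ t in atTop, ∀ t' > t, ∀ x ∈ geodesicSegment p (γ t'),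
      dist p x = dist p (γ t) → dist (γ t) x ≤ ε * dist p (γ t) := by
  -- With `D = dist p (γ s)` and `ρ = dist p (γ t)` the bound becomes `ε / 2 * ρ + 4 * D`, and `ρ ≥
  -- 8 * D / ε` absorbs the last term.
  set K := min 1 (ε / 4) with hKdef
  have hK0 : 0 < K := by positivity
  have hK1 : K ≤ 1 := min_le_left _ _
  have hKε : K ≤ ε / 4 := min_le_right _ _
  obtain ⟨s, hs, H⟩ := exists_totalCurvature_lt hγ hτ hK0
  filter_upwards [eventually_gt_atTop s, (hX.tendsto_dist hγ hτ p).eventually_ge_atTop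
    (8 * dist p (γ s) / ε)] with t ht hρ t' ht' x hx hdx
  have h1 := hX.dist_le_of_chord hγ p hs.le ht ht' (hK1.trans_lt one_lt_pi_div_two)
    (H t' (ht.trans ht')) hx hdx
  have h2 := dist_triangle (γ s) p (γ t)
  rw [dist_comm (γ s) p] at h2
  rw [div_le_iff₀ hε] at hρ
  have h3 : K * dist (γ s) (γ t) ≤ ε / 4 * dist p (γ t) + dist p (γ s) := by
    calc K * dist (γ s) (γ t) ≤ K * (dist p (γ s) + dist p (γ t)) := by gcongr
      _ = K * dist p (γ s) + K * dist p (γ t) := mul_add _ _ _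
      _ ≤ 1 * dist p (γ s) + ε / 4 * dist p (γ t) := by gcongr
      _ = _ := by ring
  linarith

theorem IsCAT0.exists_ray (hX : IsCAT0 X) [CompleteSpace X] (hγ : HasUnitSpeedOn γ (Set.Ici 0))
    (hτ : Tendsto (fun t : ℝ => totalCurvature γ 0 t) atTop (𝓝 (τγ : ℝ≥0∞))) (p : X) :
    ∃ σ : ℝ → X, IsGeodesicRay σ ∧ σ 0 = p ∧
      (fun t : ℝ => distToRay (γ t) σ) =o[atTop] (fun t : ℝ => t) := by
  choose G hG using fun t : ℝ => hX.exists_geodesic p (γ t)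
  have hρ := hX.tendsto_dist hγ hτ p
  have hρn : ∀ R, ∀ᶠ n : ℕ in atTop, R ≤ dist p (γ n) := fun R =>
    tendsto_natCast_atTop_atTop.eventually (hρ.eventually_ge_atTop R)
  have hcauchy : ∀ R, 0 ≤ R → CauchySeq fun n : ℕ => G n R := by
    intro R hR
    rw [Metric.cauchySeq_iff']
    intro ε hε
    have hε' : 0 < ε / (2 * (R + 1)) := by positivity
    obtain ⟨t, happ, hRt, hpos⟩ := ((hX.exists_dist_le_mul hγ hτ p hε').and
      ((hρ.eventually_ge_atTop R).and (hρ.eventually_gt_atTop 0))).exists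
    obtain ⟨N, hN⟩ := eventually_atTop.1 ((hρn (dist p (γ t))).and
      (tendsto_natCast_atTop_atTop.eventually (eventually_gt_atTop t)))
    -- At radius `dist p (γ t)` the segments to `γ t` and `γ n` are close relative to that radius;
    -- comparison scales this down to radius `R`.
    have key : ∀ n ≥ N, dist (G t R) (G n R) < ε / 2 := by
      intro n hn
      obtain ⟨hn1, hn2⟩ := hN n hn
      have hmem : dist p (γ t) ∈ Set.Icc 0 (dist p (γ n)) := ⟨dist_nonneg, hn1⟩
      have hd := (hG n).dist_left hmem
      have h1 := happ n hn2 _ ((hG n).mem_segment hmem) hd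
      have h2 := hX.dist_le_mul ((hG t).mem_segment ⟨hR, hRt⟩)
        (((hG n).restrict hmem).mem_segment (s := R) ⟨hR, by rwa [hd]⟩)
        (l := R / dist p (γ t)) ⟨by positivity, (div_le_one hpos).2 hRt⟩
        (by rw [(hG t).dist_left ⟨hR, hRt⟩, div_mul_cancel₀ _ hpos.ne'])
        (by rw [(hG n).dist_left ⟨hR, hRt.trans hn1⟩, hd, div_mul_cancel₀ _ hpos.ne'])
      calc dist (G t R) (G n R) ≤ R / dist p (γ t) * (ε / (2 * (R + 1)) * dist p (γ t)) :=
            h2.trans (by gcongr)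
        _ = ε / 2 * (R / (R + 1)) := by field_simp
        _ < ε / 2 * 1 := by
          gcongr
          rw [div_lt_one (by positivity)]
          linarith
        _ = ε / 2 := mul_one _
    refine ⟨N, fun n hn => ?_⟩
    have := dist_triangle_left (G n R) (G N R) (G t R)
    linarith [key n hn, key N le_rfl]
  have hlim : ∀ R, ∃ x, 0 ≤ R → Tendsto (fun n : ℕ => G n R) atTop (𝓝 x) := by
    intro R
    by_cases hR : 0 ≤ R
    · obtain ⟨x, hx⟩ := cauchySeq_tendsto_of_complete (hcauchy R hR)
      exact ⟨x, fun _ => hx⟩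
    · exact ⟨p, fun h => absurd h hR⟩
  choose σ hσ using hlim
  refine ⟨σ, fun s hs t ht => ?_, ?_, ?_⟩
  · refine tendsto_nhds_unique ((hσ s hs).dist (hσ t ht)) (tendsto_const_nhds.congr' ?_)
    filter_upwards [hρn s, hρn t] with n h1 h2
    exact ((hG n).2.2 s ⟨hs, h1⟩ t ⟨ht, h2⟩).symm
  · refine tendsto_nhds_unique (hσ 0 le_rfl) (tendsto_const_nhds.congr fun n => ?_)
    exact (hG n).1.symm
  · rw [Asymptotics.isLittleO_iff]
    intro c hc
    -- For `t ≥ dist p (γ 0)` one has `dist p (γ t) ≤ 2 * t`, hence `c / 2`.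
    filter_upwards [hX.exists_dist_le_mul hγ hτ p (half_pos hc), eventually_ge_atTop 0,
      eventually_ge_atTop (dist p (γ 0))] with t happ ht0 ht
    have h1 : dist (γ t) (σ (dist p (γ t))) ≤ c / 2 * dist p (γ t) := by
      refine le_of_tendsto (tendsto_const_nhds.dist (hσ _ dist_nonneg)) ?_
      filter_upwards [hρn (dist p (γ t)),
        tendsto_natCast_atTop_atTop.eventually (eventually_gt_atTop t)] with n hn1 hn2
      have hmem : dist p (γ t) ∈ Set.Icc 0 (dist p (γ n)) := ⟨dist_nonneg, hn1⟩
      exact happ n hn2 _ ((hG n).mem_segment hmem) ((hG n).dist_left hmem)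
    have h2 : distToRay (γ t) σ ≤ dist (γ t) (σ (dist p (γ t))) :=
      Metric.infDist_le_dist_of_mem ⟨_, dist_nonneg, rfl⟩
    have h3 := dist_triangle p (γ 0) (γ t)
    have h4 := dist_le_of_hasUnitSpeedOn hγ le_rfl ht0
    rw [Real.norm_of_nonneg (show 0 ≤ distToRay (γ t) σ from Metric.infDist_nonneg),
      Real.norm_of_nonneg ht0]
    nlinarith

/-! ### Curves with integrable remaining curvature -/

/-- Almost nearest points on the ray to two given points may come in either order. -/
theorem IsGeodesicRay.exists_between {σ : ℝ → X} (hσ : IsGeodesicRay σ) {i j l : ℝ} (hi : 0 ≤ i)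
    (hj : 0 ≤ j) (hl : l ∈ Set.Icc (0 : ℝ) 1) : ∃ z ∈ σ '' Set.Ici 0,
      z ∈ geodesicSegment (σ i) (σ j) ∧ dist (σ i) z = l * dist (σ i) (σ j) := by
  rcases le_total i j with hij | hij
  · have hd : dist (σ i) (σ j) = j - i := by
      rw [hσ i hi j hj, abs_sub_comm, abs_of_nonneg (sub_nonneg.2 hij)]
    have hgeo : IsGeodesicFromTo (fun t => σ (i + t)) (σ i) (σ j) := by
      refine ⟨by simp, by simp [hd], fun s hs t ht => ?_⟩
      rw [hσ _ (by linarith [hs.1]) _ (by linarith [ht.1]), add_sub_add_left_eq_sub]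
    have hmem : l * (j - i) ∈ Set.Icc 0 (dist (σ i) (σ j)) := by
      rw [hd]
      exact ⟨mul_nonneg hl.1 (by linarith), mul_le_of_le_one_left (by linarith) hl.2⟩
    exact ⟨σ (i + l * (j - i)), ⟨_, by simpa using add_nonneg hi hmem.1, rfl⟩,
      hgeo.mem_segment hmem, by rw [hd]; exact hgeo.dist_left hmem⟩
  · have hd : dist (σ i) (σ j) = i - j := by
      rw [hσ i hi j hj, abs_of_nonneg (sub_nonneg.2 hij)]
    have hgeo : IsGeodesicFromTo (fun t => σ (i - t)) (σ i) (σ j) := by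
      refine ⟨by simp, by simp [hd], fun s hs t ht => ?_⟩
      rw [hd] at hs ht
      rw [hσ _ (by linarith [hs.2]) _ (by linarith [ht.2]), sub_sub_sub_cancel_left, abs_sub_comm]
    have hmem : l * (i - j) ∈ Set.Icc 0 (dist (σ i) (σ j)) := by
      rw [hd]
      exact ⟨mul_nonneg hl.1 (by linarith), mul_le_of_le_one_left (by linarith) hl.2⟩
    refine ⟨σ (i - l * (i - j)), ⟨_, ?_, rfl⟩,
      hgeo.mem_segment hmem, by rw [hd]; exact hgeo.dist_left hmem⟩
    have := hmem.2
    rw [hd] at this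
    simp only [Set.mem_Ici]
    linarith

/-- The distance to a ray is convex. -/
theorem IsCAT0.distToRay_convex (hX : IsCAT0 X) {σ : ℝ → X} (hσ : IsGeodesicRay σ) {q q' x : X}
    (hx : x ∈ geodesicSegment q q') {l : ℝ} (hl : l ∈ Set.Icc (0 : ℝ) 1)
    (hdx : dist q x = l * dist q q') :
    distToRay x σ ≤ (1 - l) * distToRay q σ + l * distToRay q' σ := by
  have hne : (σ '' Set.Ici 0).Nonempty := ⟨σ 0, 0, Set.mem_Ici.2 le_rfl, rfl⟩
  apply le_of_forall_pos_le_add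
  intro ε hε
  obtain ⟨_, ⟨i, hi, rfl⟩, hi'⟩ := (Metric.infDist_lt_iff hne).1
    (show Metric.infDist q (σ '' Set.Ici 0) < distToRay q σ + ε from lt_add_of_pos_right _ hε)
  obtain ⟨_, ⟨j, hj, rfl⟩, hj'⟩ := (Metric.infDist_lt_iff hne).1
    (show Metric.infDist q' (σ '' Set.Ici 0) < distToRay q' σ + ε from lt_add_of_pos_right _ hε)
  obtain ⟨z, hz, hzs, hdz⟩ := hσ.exists_between hi hj hl
  have h1 := hX.dist_le_convex hx hzs hl hdx hdz
  have h2 : distToRay x σ ≤ dist x z := Metric.infDist_le_dist_of_mem hz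
  have h3 := mul_le_mul_of_nonneg_left hi'.le (sub_nonneg.2 hl.2)
  have h4 := mul_le_mul_of_nonneg_left hj'.le hl.1
  linarith

theorem distToRay_le_add (x y : X) (σ : ℝ → X) : distToRay x σ ≤ distToRay y σ + dist x y :=
  Metric.infDist_le_infDist_add_dist

/-- `γ s'` is within `K * (s' - s)` of a point `x` of the chord `[γ s, γ t]`. By convexity the far
end adds at most `dist (γ s) (γ s') / dist (γ s) (γ t) * distToRay (γ t) σ` at `x`, which tends to
`0` as `t → ∞` because `dist (γ s) (γ t)` grows linearly. -/
theorem IsCAT0.distToRay_le_of_totalCurvature_lt (hX : IsCAT0 X)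
    (hγ : HasUnitSpeedOn γ (Set.Ici 0))
    (hτ : Tendsto (fun t : ℝ => totalCurvature γ 0 t) atTop (𝓝 (τγ : ℝ≥0∞))) {σ : ℝ → X}
    (hσ : IsGeodesicRay σ) (ho : (fun t : ℝ => distToRay (γ t) σ) =o[atTop] (fun t : ℝ => t))
    {s s' K : ℝ} (hs : 0 ≤ s) (hss' : s < s') (hK : K < Real.pi / 2)
    (H : ∀ t > s, totalCurvature γ s t < ENNReal.ofReal K) :
    distToRay (γ s') σ ≤ distToRay (γ s) σ + K * (s' - s) := by
  have hK0 : 0 < K := ENNReal.ofReal_pos.1 (bot_le.trans_lt (H s' hss'))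
  have hlim := (ho.trans_isBigO (hX.isBigO_dist hγ hτ (γ s))).tendsto_div_nhds_zero
  have hlim' := (hlim.const_mul (dist (γ s) (γ s'))).const_add
    (distToRay (γ s) σ + K * (s' - s))
  rw [mul_zero, add_zero] at hlim'
  refine ge_of_tendsto hlim' ?_
  filter_upwards [eventually_gt_atTop s',
    (hX.tendsto_dist hγ hτ (γ s)).eventually_gt_atTop 0] with t ht hpos
  obtain ⟨hle, hchord⟩ := hX.curve_dist_chord hγ hs hss' ht hK (H t (hss'.trans ht))
  obtain ⟨x, hx, hdx⟩ := hX.exists_mem_segment ⟨dist_nonneg, hle⟩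
  have h1 := hchord x hx hdx
  have hl : dist (γ s) (γ s') / dist (γ s) (γ t) ∈ Set.Icc (0 : ℝ) 1 :=
    ⟨by positivity, (div_le_one hpos).2 hle⟩
  have h2 := hX.distToRay_convex hσ hx hl (by rw [hdx, div_mul_cancel₀ _ hpos.ne'])
  have h3 := distToRay_le_add (γ s') x σ
  have h4 := mul_le_mul_of_nonneg_left (dist_le_of_hasUnitSpeedOn hγ hs hss'.le) hK0.le
  have h5 : (1 - dist (γ s) (γ s') / dist (γ s) (γ t)) * distToRay (γ s) σ ≤ distToRay (γ s) σ :=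
    mul_le_of_le_one_left Metric.infDist_nonneg (by linarith [hl.1])
  have h6 : dist (γ s) (γ s') / dist (γ s) (γ t) * distToRay (γ t) σ =
      dist (γ s) (γ s') * (distToRay (γ t) σ / dist (γ s) (γ t)) := by ring
  linarith

/-- Integral test: the remaining curvature is nonincreasing for positive times, so its value at `n +
1` is at most its integral over `(n, n + 1]`. -/
theorem summable_tail (hγ : HasUnitSpeedOn γ (Set.Ici 0))
    (hint : (∫⁻ t in Set.Ici (0 : ℝ), ((τγ : ℝ≥0∞) - totalCurvature γ 0 t)) < ∞) :
    Summable fun n : ℕ => ((τγ : ℝ≥0∞) - totalCurvature γ 0 n).toReal := by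
  rw [← summable_nat_add_iff 1]
  apply ENNReal.summable_toReal
  refine ne_top_of_le_ne_top hint.ne ?_
  have hdisj : Pairwise (Function.onFun Disjoint fun n : ℕ => Set.Ioc (n : ℝ) (n + 1)) := by
    intro m n hmn
    have := Set.pairwise_disjoint_Ioc_add_intCast (0 : ℝ) (Nat.cast_injective.ne hmn)
    simpa [Function.onFun] using this
  calc ∑' n : ℕ, ((τγ : ℝ≥0∞) - totalCurvature γ 0 ((n + 1 : ℕ) : ℝ))
      ≤ ∑' n : ℕ, ∫⁻ t in Set.Ioc (n : ℝ) (n + 1), ((τγ : ℝ≥0∞) - totalCurvature γ 0 t) := by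
        refine ENNReal.tsum_le_tsum fun n => ?_
        have : ∫⁻ _ in Set.Ioc (n : ℝ) (n + 1),
            ((τγ : ℝ≥0∞) - totalCurvature γ 0 ((n + 1 : ℕ) : ℝ)) =
            (τγ : ℝ≥0∞) - totalCurvature γ 0 ((n + 1 : ℕ) : ℝ) := by
          simp
        rw [← this]
        refine MeasureTheory.setLIntegral_mono' measurableSet_Ioc fun t ht => ?_
        exact tsub_le_tsub_left (totalCurvature_mono hγ (n.cast_nonneg.trans_lt ht.1)
          (by push_cast; exact ht.2)) _
    _ = ∫⁻ t in ⋃ n : ℕ, Set.Ioc (n : ℝ) (n + 1), ((τγ : ℝ≥0∞) - totalCurvature γ 0 t) :=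
        (MeasureTheory.lintegral_iUnion (fun _ => measurableSet_Ioc) hdisj _).symm
    _ ≤ _ := by
        refine MeasureTheory.lintegral_mono_set ?_
        exact Set.iUnion_subset fun n t ht => n.cast_nonneg.trans ht.1.le

theorem IsCAT0.isAsymptotic (hX : IsCAT0 X) (hγ : HasUnitSpeedOn γ (Set.Ici 0))
    (hτ : Tendsto (fun t : ℝ => totalCurvature γ 0 t) atTop (𝓝 (τγ : ℝ≥0∞)))
    (hint : (∫⁻ t in Set.Ici (0 : ℝ), ((τγ : ℝ≥0∞) - totalCurvature γ 0 t)) < ∞) {σ : ℝ → X}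
    (hσ : IsGeodesicRay σ) (ho : (fun t : ℝ => distToRay (γ t) σ) =o[atTop] (fun t : ℝ => t)) :
    IsAsymptotic γ σ := by
  -- The summable term `(1 / 2) ^ n` makes the curvature bound strict.
  set κ : ℕ → ℝ := fun n => ((τγ : ℝ≥0∞) - totalCurvature γ 0 n).toReal + (1 / 2) ^ n with hκ
  have hsum : Summable κ := (summable_tail hγ hint).add summable_geometric_two
  have hκ0 : ∀ n, 0 ≤ κ n := fun n => by positivity
  obtain ⟨N, hN⟩ := eventually_atTop.1 ((hsum.tendsto_atTop_zero.eventually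
    (gt_mem_nhds (show (0 : ℝ) < Real.pi / 2 by positivity))).and (eventually_gt_atTop 0))
  have hstep : ∀ n ≥ N, distToRay (γ ((n + 1 : ℕ) : ℝ)) σ ≤ distToRay (γ n) σ + κ n := by
    intro n hn
    obtain ⟨h1, h2⟩ := hN n hn
    have := hX.distToRay_le_of_totalCurvature_lt hγ hτ hσ ho (s := n) (s' := (n + 1 : ℕ)) (K := κ n)
      n.cast_nonneg (by push_cast; linarith) h1 (fun t ht => by
        refine (totalCurvature_le_tail hγ hτ (by exact_mod_cast h2) ht).trans_lt ?_
        refine (ENNReal.lt_ofReal_iff_toReal_lt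
          (ne_top_of_le_ne_top ENNReal.coe_ne_top tsub_le_self)).2 ?_
        simp [hκ])
    simpa using this
  have hbound : ∀ n ≥ N, distToRay (γ n) σ ≤
      distToRay (γ N) σ + ∑ i ∈ Finset.range n, κ i := by
    intro n hn
    induction n, hn using Nat.le_induction with
    | base => exact le_add_of_nonneg_right (Finset.sum_nonneg fun i _ => hκ0 i)
    | succ n hn ih =>
      rw [Finset.sum_range_succ]
      linarith [hstep n hn]
  have hNn : 0 ≤ distToRay (γ N) σ := Metric.infDist_nonneg
  have hts : 0 ≤ ∑' i, κ i := tsum_nonneg hκ0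
  -- `N` covers the times before `N`, and `1` the passage from `⌊t⌋₊` to `t`.
  refine ⟨distToRay (γ N) σ + ∑' i, κ i + N + 1, fun t ht => ?_⟩
  have hN0 : (0 : ℝ) ≤ N := N.cast_nonneg
  rcases le_total t N with htN | htN
  · have h1 := distToRay_le_add (γ t) (γ N) σ
    have h2 := dist_le_of_hasUnitSpeedOn hγ ht htN
    linarith
  · have h1 := distToRay_le_add (γ t) (γ ⌊t⌋₊) σ
    have h2 := dist_le_of_hasUnitSpeedOn hγ (Nat.cast_nonneg ⌊t⌋₊) (Nat.floor_le ht)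
    rw [dist_comm] at h2
    have h3 := hbound ⌊t⌋₊ (Nat.le_floor htN)
    have h4 := hsum.sum_le_tsum (Finset.range ⌊t⌋₊) fun i _ => hκ0 i
    linarith [Nat.lt_floor_add_one t]

end FiniteTotalCurvature

end CatZero

theorem mainTheorem3 {X : Type*} [MetricSpace X] (hX : CatZero.IsCAT0 X)
    (γ : ℝ → X) (hγ : HasUnitSpeedOn γ (Set.Ici 0))
    (τγ : ℝ≥0)
    (hτ : Filter.Tendsto (fun t : ℝ => CatZero.totalCurvature γ 0 t) Filter.atTop
      (𝓝 (τγ : ℝ≥0∞))) :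
    (CompleteSpace X → ∀ p : X, ∃ σ : ℝ → X, CatZero.IsGeodesicRay σ ∧ σ 0 = p ∧
      (fun t : ℝ => CatZero.distToRay (γ t) σ) =o[Filter.atTop] (fun t : ℝ => t)) ∧
    ((fun t : ℝ => t) =O[Filter.atTop] CatZero.circumradius γ) ∧
    ((∫⁻ t in Set.Ici (0 : ℝ), ((τγ : ℝ≥0∞) - CatZero.totalCurvature γ 0 t)) < ∞ →
      ∀ σ : ℝ → X, CatZero.IsGeodesicRay σ →
        (fun t : ℝ => CatZero.distToRay (γ t) σ) =o[Filter.atTop] (fun t : ℝ => t) →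
        CatZero.IsAsymptotic γ σ) :=
  ⟨fun _ p => hX.exists_ray hγ hτ p, hX.isBigO_circumradius hγ hτ,
    fun hint _ hσ ho => hX.isAsymptotic hγ hτ hint hσ ho⟩
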